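/- **Setting.** Let $\nu$ be a $\sigma$-finite measure on a measurable space and $f_0,f_1$ two probability densities with respect to $\nu$ whose Kullback–Leibler divergences $I_0=\int\log(f_0/f_1)f_0\,d\nu$ and $I_1=\int\log(f_1/f_0)f_1\,d\nu$ are positive and finite. Under $\mathsf P_i$ (expectation $\mathsf E_i$), $i\in\{0,1\}$, the observations $X_1,X_2,\dots$ are i.i.d. with density $f_i$; put $\mathcal F_n=\sigma(X_1,\dots,X_n)$, $\Lambda_n=\sum_{k=1}^n\log\frac{f_1(X_k)}{f_0(X_k)}$ and $\bar\Lambda_n=\Lambda_n/n$. A test $(T,D)$ consists of an $(\mathcal F_n)_{n\ge1}$-stopping time $T$ with values in the positive integers, finite with probability one under $\mathsf P_0$ and $\mathsf P_1$, and an $\mathcal F_T$-measurable decision $D\in\{0,1\}$. For $\alpha,\beta\in(0,1)$, $\mathcal E(\alpha,\beta)$ is the class of tests with $\mathsf P_0(D=1)\le\alpha$ and $\mathsf P_1(D=0)\le\beta$, and $\mathcal L_i(\alpha,\beta)=\inf_{(T,D)\in\mathcal E(\alpha,\beta)}\mathsf E_i[T]$. A family of tests $(T^*(\alpha,\beta),D^*(\alpha,\beta))$,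 $\alpha,\beta\in(0,1)$, is *asymptotically optimal under the null* if $(T^*(\alpha,\beta),D^*(\alpha,\beta))\in\mathcal E(\alpha,\beta)$ for all $\alpha,\beta\in(0,1)$ and $\mathsf E_0[T^*(\alpha,\beta)]\sim\mathcal L_0(\alpha,\beta)$ as $\alpha,\beta\to0$. Here and below, $\alpha,\beta\to 0$ jointly at arbitrary rates, and $x\sim y$, $x\lesssim y$, $x\ll y$, $x\gg y$ mean $\lim x/y=1$, $\limsup x/y\le1$, $\lim x/y=0$, $\lim x/y=\infty$. For $a,\delta\in(0,1)$ let $n^*(a,\delta)$ be the smallest integer $n\ge1$ for which some $c\in\mathbb R$ satisfies $\mathsf P_0(\bar\Lambda_n>c)\le a$ and $\mathsf P_1(\bar\Lambda_n\le c)\le\delta$, let $c^*(a,\delta)$ be the smallest such $c$ for $n=n^*(a,\delta)$, and put $\mathsf{FSST}(a,\delta)=(n^*(a,\delta),c^*(a,\delta))$. **The two tests.** Let $K=K(\alpha,\beta)\ge1$ be an integer. Given stage sizes $m_j$, thresholds $b_j$ and statistics $\Lambda'_j$, $1\le j\le K$, and $M_j=m_1+\dots+m_j$, $M_0=0$, the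 corresponding $K$-stage test stops after $M_j$ observations and accepts the null at the first stage $j\le K$ with $\Lambda'_j\le b_j$; if $\Lambda'_j>b_j$ for all $j\le K$, it stops after $M_K$ observations and rejects the null. Put $\delta_1=\beta-\sum_{i=2}^K(\beta/2)^i$ and $\delta_j=(\beta/2)^j$ for $2\le j\le K$. * *Sequential Thresholding* $(T',D')$: $(m_j,b_j)=\mathsf{FSST}(\alpha^{1/K},\delta_j)$ for $1\le j\le K$, and $\Lambda'_j=(\Lambda_{M_j}-\Lambda_{M_{j-1}})/m_j$. * *Modified Sequential Thresholding* $(T'',D'')$: $\Lambda'_j=\bar\Lambda_{M_j}$, $(m_1,b_1)=\mathsf{FSST}(\alpha^{1/K},\delta_1)$ and, recursively for $2\le j\le K$, $m_j$ is the smallest integer $n$ for which some $b\in\mathbb R$ satisfies $$\mathsf P_0\Big(\bar\Lambda_{M_{j-1}+n}>b,\ \bigcap_{i=1}^{j-1}\{\bar\Lambda_{M_i}>b_i\}\Big)\le\alpha^{j/K}\quad\text{and}\quad\mathsf P_1\big(\bar\Lambda_{M_{j-1}+n}\le b\big)\le(\beta/2)^j ,$$ and $b_j$ is the smallest such $b$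 for $n=m_j$ (with $b_j=-\infty$, i.e. the stage is always passed, if these $b$ are not bounded below). In the definition of $m_j$, $j\ge2$, $n$ ranges either over the positive or over the nonnegative integers; the theorem holds under either convention. **Theorem.** As $\alpha,\beta\to0$, the condition $$\alpha^{1/K}\to0\quad\text{and}\quad|\log\alpha^{1/K}|\ll|\log\beta|$$ is equivalent to $$\frac{|\log\alpha|}{|\log\beta|}\ll K\ll|\log\alpha| .$$ If it holds, then the families $(T'(\alpha,\beta),D'(\alpha,\beta))$ and $(T''(\alpha,\beta),D''(\alpha,\beta))$, $\alpha,\beta\in(0,1)$, are both asymptotically optimal under the null. Moreover, as $\alpha,\beta\to0$, $$\mathsf E_1[T'(\alpha,\beta)]\sim\frac{K(K+1)}2\,\frac{|\log\beta|}{I_0}\gg\frac{K+1}2\,\mathcal L_1(\alpha,\beta),$$ $$\mathsf E_1[T''(\alpha,\beta)]\lesssim K\,\frac{|\log\beta|}{I_0}\sim\frac{2}{K+1}\,\mathsf E_1[T'(\alpha,\beta)] .$$ -/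

import Mathlib

open MeasureTheory Filter Set
open scoped Topology ENNReal

/-! Asymptotic relations, for positive quantities, along a filter `l`. -/

/-- `x ∼ y` : `lim x / y = 1`. -/
def AsympEquiv {ι : Type*} (l : Filter ι) (x y : ι → ℝ≥0∞) : Prop :=
  Tendsto (fun a => x a / y a) l (𝓝 1)

/-- `x ≲ y` : `limsup x / y ≤ 1`. -/
def AsympLE {ι : Type*} (l : Filter ι) (x y : ι → ℝ≥0∞) : Prop :=
  limsup (fun a => x a / y a) l ≤ 1

/-- `x ≫ y` : `lim x / y = ∞`. -/
def MuchGreater {ι : Type*} (l : Filter ι) (x y : ι → ℝ≥0∞) : Prop :=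
  Tendsto (fun a => x a / y a) l (𝓝 ∞)

/-- `x ≪ y` for real-valued quantities: `lim x / y = 0`. -/
def MuchLess {ι : Type*} (l : Filter ι) (x y : ι → ℝ) : Prop :=
  Tendsto (fun a => x a / y a) l (𝓝 0)

/-- The regime `α, β → 0` (through positive values, at arbitrary rates). -/
def smallErrors : Filter (ℝ × ℝ) := 𝓝[>] (0 : ℝ) ×ˢ 𝓝[>] (0 : ℝ)

/-- Two probability densities `f 0`, `f 1` with respect to a common `σ`-finite measure `ν`,
that is, two simple hypotheses about the common density of a sequence of independent
observations. -/
structure SimpleTesting (S : Type*) [MeasurableSpace S] where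
  ν : Measure S
  sigmaFinite_ν : SigmaFinite ν
  f : Fin 2 → S → ℝ
  measurable_f : ∀ i, Measurable (f i)
  f_nonneg : ∀ i x, 0 ≤ f i x
  lintegral_f : ∀ i, ∫⁻ x, ENNReal.ofReal (f i x) ∂ν = 1

namespace SimpleTesting

variable {S : Type*} [MeasurableSpace S] (H : SimpleTesting S)

/-- The law of one observation under the hypothesis `i`. -/
noncomputable def law (i : Fin 2) : Measure S :=
  H.ν.withDensity fun x => ENNReal.ofReal (H.f i x)

instance isProbabilityMeasure_law (i : Fin 2) : IsProbabilityMeasure (H.law i) :=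
  ⟨by simp [law, withDensity_apply _ MeasurableSet.univ, H.lintegral_f i]⟩

/-- The Kullback-Leibler divergence `∫ log (f i / f (1 - i)) f i dν`, as an extended nonnegative
number (it is `∞` if the law under `i` is not absolutely continuous with respect to the other
one). -/
noncomputable def kl (i : Fin 2) : ℝ≥0∞ := InformationTheory.klDiv (H.law i) (H.law (1 - i))

/-- The real number `I_i`. -/
noncomputable def I (i : Fin 2) : ℝ := (H.kl i).toReal

/-- The distribution of the sequence of observations under the hypothesis `i`. The `n`-th
observation, `n ≥ 1`, is the coordinate `ω (n - 1)`. -/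
noncomputable def P (i : Fin 2) : Measure (ℕ → S) := Measure.infinitePi fun _ => H.law i

/-- The log-likelihood ratio `Λ_n` of the first `n` observations. -/
noncomputable def llr (n : ℕ) (ω : ℕ → S) : ℝ :=
  ∑ i ∈ Finset.range n, Real.log (H.f 1 (ω i) / H.f 0 (ω i))

/-- The average log-likelihood ratio `Λ_n / n` of the first `n` observations. -/
noncomputable def avgLlr (n : ℕ) (ω : ℕ → S) : ℝ := H.llr n ω / n

/-- The `σ`-algebra generated by the first `n` observations. -/
abbrev obs (S : Type*) [MeasurableSpace S] (n : ℕ) : MeasurableSpace (ℕ → S) :=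
  ⨆ i : Fin n, MeasurableSpace.comap (fun ω : ℕ → S => ω i) inferInstance

/-- `(T, D)` is a (sequential) test: `T` is a stopping time with values in the positive integers,
finite with probability one under both hypotheses, and `D` is a binary decision that depends only
on the observations collected up to time `T`. -/
structure IsTest (T : (ℕ → S) → ℕ∞) (D : (ℕ → S) → Fin 2) : Prop where
  one_le : ∀ ω, 1 ≤ T ω
  finite : ∀ i, ∀ᵐ ω ∂(H.P i), T ω ≠ ⊤
  stopping : ∀ n : ℕ, 1 ≤ n → MeasurableSet[obs S n] {ω | T ω = n}
  measurable_decision : Measurable D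
  decision : ∀ n : ℕ, 1 ≤ n → ∀ i : Fin 2, MeasurableSet[obs S n] {ω | T ω = n ∧ D ω = i}

/-- The class `𝓔(α, β)` of tests with error probabilities at most `α` and `β`. -/
def testClass (α β : ℝ) : Set (((ℕ → S) → ℕ∞) × ((ℕ → S) → Fin 2)) :=
  {χ | H.IsTest χ.1 χ.2 ∧
    (H.P 0).real {ω | χ.2 ω = 1} ≤ α ∧ (H.P 1).real {ω | χ.2 ω = 0} ≤ β}

/-- The expected sample size `E_i[T]`. -/
noncomputable def ess (i : Fin 2) (T : (ℕ → S) → ℕ∞) : ℝ≥0∞ :=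
  ∫⁻ ω, (T ω : ℝ≥0∞) ∂(H.P i)

/-- The optimal expected sample size `𝓛_i(α, β)` under hypothesis `i`. -/
noncomputable def optEss (i : Fin 2) (α β : ℝ) : ℝ≥0∞ :=
  ⨅ χ ∈ H.testClass α β, H.ess i χ.1

/-- Asymptotic optimality under the null hypothesis of a family of tests indexed by `(α, β)`. -/
def AsympOptimalNull (χ : ℝ → ℝ → ((ℕ → S) → ℕ∞) × ((ℕ → S) → Fin 2)) : Prop :=
  (∀ α ∈ Ioo (0 : ℝ) 1, ∀ β ∈ Ioo (0 : ℝ) 1, χ α β ∈ H.testClass α β) ∧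
  AsympEquiv smallErrors (fun p => H.ess 0 (χ p.1 p.2).1) (fun p => H.optEss 0 p.1 p.2)

/-! ### The fixed-sample-size test -/

/-- The smallest sample size `n^*(α, β)`. -/
noncomputable def nStar (α β : ℝ) : ℕ :=
  sInf {n : ℕ | 1 ≤ n ∧ ∃ c : ℝ, (H.P 0).real {ω | c < H.avgLlr n ω} ≤ α ∧
    (H.P 1).real {ω | H.avgLlr n ω ≤ c} ≤ β}

/-- The smallest threshold `c^*(α, β)` for the sample size `n^*(α, β)`. -/
noncomputable def cStar (α β : ℝ) : ℝ :=
  sInf {c : ℝ | (H.P 0).real {ω | c < H.avgLlr (H.nStar α β) ω} ≤ α ∧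
    (H.P 1).real {ω | H.avgLlr (H.nStar α β) ω ≤ c} ≤ β}

/-! ### Multistage tests that can reject only at the last stage -/

/-- The stage at which the test with at most `K` stages, statistics `stat j` and thresholds `b j`
(`j = 1, …, K`) stops: the first `j` with `stat j ≤ b j`, or `K` if there is none before. -/
noncomputable def lastStage (K : ℕ) (stat : ℕ → (ℕ → S) → ℝ) (b : ℕ → EReal) (ω : ℕ → S) : ℕ :=
  sInf {j : ℕ | 1 ≤ j ∧ (j = K ∨ (stat j ω : EReal) ≤ b j)}

open Classical in
/-- The test (sample size and decision) with at most `K` stages, the `j`-th of which ends after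
`M j` observations in total: accept the null at the first stage `j` with `stat j ≤ b j`, and
reject it if `stat j > b j` for every `j = 1, …, K`. -/
noncomputable def stagedTest (K : ℕ) (M : ℕ → ℕ) (stat : ℕ → (ℕ → S) → ℝ) (b : ℕ → EReal) :
    ((ℕ → S) → ℕ∞) × ((ℕ → S) → Fin 2) :=
  (fun ω => (M (lastStage K stat b ω) : ℕ∞),
   fun ω => if ∀ j ∈ Finset.Icc 1 K, b j < (stat j ω : EReal) then 1 else 0)

/-- The type-II error probability allotted to stage `j` (`j = 1, …, K`). -/
noncomputable def typeIILevel (β : ℝ) (K j : ℕ) : ℝ :=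
  if j = 1 then β - ∑ i ∈ Finset.Icc 2 K, (β / 2) ^ i else (β / 2) ^ j

/-! ### Sequential Thresholding -/

/-- The size `m_j` of stage `j` of ST. -/
noncomputable def stSize (α β : ℝ) (K j : ℕ) : ℕ :=
  H.nStar (α ^ (1 / (K : ℝ))) (typeIILevel β K j)

/-- The threshold `b_j` of stage `j` of ST. -/
noncomputable def stThreshold (α β : ℝ) (K j : ℕ) : ℝ :=
  H.cStar (α ^ (1 / (K : ℝ))) (typeIILevel β K j)

/-- The total number `M_j = m_1 + ⋯ + m_j` of observations in the first `j` stages of ST. -/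
noncomputable def stTotal (α β : ℝ) (K j : ℕ) : ℕ := ∑ i ∈ Finset.Icc 1 j, H.stSize α β K i

/-- The statistic of stage `j` of ST: the average log-likelihood ratio of the observations
collected during stage `j` only. -/
noncomputable def stStat (α β : ℝ) (K j : ℕ) (ω : ℕ → S) : ℝ :=
  (H.llr (H.stTotal α β K j) ω - H.llr (H.stTotal α β K (j - 1)) ω) / H.stSize α β K j

/-- Sequential Thresholding with at most `K` stages. -/
noncomputable def ST (α β : ℝ) (K : ℕ) : ((ℕ → S) → ℕ∞) × ((ℕ → S) → Fin 2) :=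
  stagedTest K (H.stTotal α β K) (H.stStat α β K) (fun j => (H.stThreshold α β K j : EReal))

/-! ### Modified Sequential Thresholding -/

/-- The data of mod-ST after some stage `j`: the total number `M_j` of observations so far, the
threshold `b_j`, and the event that the threshold has been exceeded at all stages `1, …, j`. -/
structure ModStage (S : Type*) where
  total : ℕ
  threshold : EReal
  passed : Set (ℕ → S)

/-- The real thresholds `b` that satisfy both error constraints, with levels `a` and `δ`, for a
stage after which `N` observations have been collected in total, when `A` is the event that all
previous thresholds have been exceeded. -/
def modThresholds (A : Set (ℕ → S)) (N : ℕ) (a δ : ℝ) : Set ℝ :=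
  {b : ℝ | (H.P 0).real ({ω | b < H.avgLlr N ω} ∩ A) ≤ a ∧
    (H.P 1).real {ω | H.avgLlr N ω ≤ b} ≤ δ}

/-- The smallest stage size, at least `r`, for which some threshold satisfies both constraints. -/
noncomputable def modSize (r : ℕ) (s : ModStage S) (a δ : ℝ) : ℕ :=
  sInf {n : ℕ | r ≤ n ∧ (H.modThresholds s.passed (s.total + n) a δ).Nonempty}

/-- The stage that follows `s`. Its threshold is the smallest one that satisfies both constraints;
if arbitrarily small thresholds do (which happens when the event of having passed the previous
stages has probability at most `a` under the null already), it is `-∞`, so that the stage is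
always passed. -/
noncomputable def modNext (r : ℕ) (s : ModStage S) (a δ : ℝ) : ModStage S :=
  let N := s.total + H.modSize r s a δ
  let b : EReal := sInf ((fun b : ℝ => (b : EReal)) '' H.modThresholds s.passed N a δ)
  { total := N
    threshold := b
    passed := s.passed ∩ {ω | b < (H.avgLlr N ω : EReal)} }

/-- The stages of mod-ST: the first is that of ST, and the later ones, of size at least `r`, are
specified recursively. (The value at `0` is the situation before the first stage.) -/
noncomputable def modStage (r : ℕ) (α β : ℝ) (K : ℕ) : ℕ → ModStage S
  | 0 => { total := 0, threshold := ⊥, passed := univ }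
  | 1 =>
    { total := H.stSize α β K 1
      threshold := (H.stThreshold α β K 1 : EReal)
      passed := {ω | H.stThreshold α β K 1 < H.avgLlr (H.stSize α β K 1) ω} }
  | j + 2 =>
    H.modNext r (modStage r α β K (j + 1)) (α ^ (((j + 2 : ℕ) : ℝ) / (K : ℝ)))
      (typeIILevel β K (j + 2))

/-- Modified Sequential Thresholding with at most `K` stages (later stages of size at least `r`):
the statistic of stage `j` is the average log-likelihood ratio of all observations collected up to
the end of stage `j`. -/
noncomputable def modST (r : ℕ) (α β : ℝ) (K : ℕ) : ((ℕ → S) → ℕ∞) × ((ℕ → S) → Fin 2) :=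
  stagedTest K (fun j => (H.modStage r α β K j).total)
    (fun j => H.avgLlr (H.modStage r α β K j).total)
    (fun j => (H.modStage r α β K j).threshold)

end SimpleTesting

/-!
Put `I = I_0` and `ℓ = |log β|`. Since `exp (-Λ_1)` has mean one under the alternative, Chernoff's
bound gives `P_1(Λ_n / n ≤ -κ) ≤ exp (-κ n)` for every `κ`; for `κ < I`, the mean `-I` of `Λ_1`
under the null lies below `-κ`, hence `P_0(Λ_n / n > -κ) ≤ exp (-ρ n)` for some `ρ > 0`. Because
`|log α ^ (1 / K)| ≪ ℓ`, the first bound is the one that matters: about `j ℓ / I` observations with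
threshold `-κ` meet both constraints of stage `j`. So the sizes of the stages of Sequential
Thresholding are at most about `j ℓ / I`, and the total sample sizes of the modified version are at
most about `j ℓ / I`. Under the null, stage `j` is reached with probability at most
`α ^ ((j - 1) / K)`, so that the later stages contribute little and `E_0[T]` is at most about
`ℓ / I`.

Conversely, by a change of measure and the law of large numbers, an event that is determined by
fewer than `(1 - ε) |log δ| / I` observations and has probability at most `δ` under the alternative
is unlikely under the null. With `δ = β` this shows that no test has `E_0[T]` much smaller than
`ℓ / I`, and with `δ = (β / 2) ^ j` that the stages of Sequential Thresholding are about as large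
as their upper bounds.

Under the alternative, all stages are passed with probability at least `1 - β`, and the stage sizes
of Sequential Thresholding add up to about `K (K + 1) / 2 * ℓ / I`. The optimum there is of smaller
order than `K ℓ`, as witnessed by a two-stage test that can reject at the first stage, where it
stops except with probability `α`: its expected size is of order `1 + |log α| + α ℓ`.
-/

section ProductMeasures

variable {ι : Type*} [Fintype ι] {X : ι → Type*} [∀ i, MeasurableSpace (X i)]
  {μ : ∀ i, Measure (X i)}

lemma lintegral_pi_prod [∀ i, IsProbabilityMeasure (μ i)] {g : ∀ i, X i → ℝ≥0∞}
    (hg : ∀ i, Measurable (g i)) :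
    ∫⁻ x, ∏ i, g i (x i) ∂Measure.pi μ = ∏ i, ∫⁻ x, g i x ∂μ i := by
  rw [ProbabilityTheory.lintegral_prod_eq_prod_lintegral_of_indepFun _ _
    (ProbabilityTheory.iIndepFun_pi fun i => (hg i).aemeasurable) (by fun_prop)]
  refine Finset.prod_congr rfl fun i _ => ?_
  rw [← lintegral_map (hg i) (measurable_pi_apply i), (measurePreserving_eval μ i).map_eq]

lemma pi_withDensity [∀ i, IsProbabilityMeasure (μ i)] {g : ∀ i, X i → ℝ≥0∞}
    (hg : ∀ i, Measurable (g i)) [∀ i, SigmaFinite ((μ i).withDensity (g i))] :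
    Measure.pi (fun i => (μ i).withDensity (g i)) =
      (Measure.pi μ).withDensity fun x => ∏ i, g i (x i) := by
  classical
  refine Measure.pi_eq fun s hs => ?_
  have hind (x : ∀ i, X i) : (univ.pi s).indicator (fun x => ∏ i, g i (x i)) x =
      ∏ i, (s i).indicator (g i) (x i) := by
    simp only [indicator_apply, mem_univ_pi, Finset.prod_ite_zero, Finset.mem_univ, true_imp_iff]
  rw [withDensity_apply _ (.univ_pi hs), ← lintegral_indicator (.univ_pi hs)]
  simp_rw [hind]
  rw [lintegral_pi_prod fun i => (hg i).indicator (hs i)]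
  simp_rw [lintegral_indicator (hs _), withDensity_apply _ (hs _)]

end ProductMeasures

namespace SimpleTesting

/-! ### Events that depend on finitely many observations -/

section Observations

variable {S : Type*} [MeasurableSpace S]

lemma obs_le (n : ℕ) : obs S n ≤ MeasurableSpace.pi :=
  iSup_le fun i => (measurable_pi_apply (i : ℕ)).comap_le

lemma measurable_obs_apply {n i : ℕ} (hi : i < n) :
    Measurable[obs S n] fun ω : ℕ → S => ω i :=
  .of_comap_le <| le_iSup
    (fun j : Fin n => MeasurableSpace.comap (fun ω : ℕ → S => ω j) inferInstance) ⟨i, hi⟩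

lemma obs_mono : Monotone (obs S) := fun _ _ h =>
  iSup_le fun i => (measurable_obs_apply (i.2.trans_le h)).comap_le

lemma exists_preimage_restrict {n : ℕ} {A : Set (ℕ → S)} (hA : MeasurableSet[obs S n] A) :
    ∃ B : Set (Finset.range n → S), MeasurableSet B ∧ (Finset.range n).restrict ⁻¹' B = A := by
  have h : obs S n ≤ MeasurableSpace.comap ((Finset.range n).restrict (π := fun _ : ℕ => S))
      MeasurableSpace.pi := by
    refine iSup_le fun i => ?_
    rintro _ ⟨t, ht, rfl⟩
    exact ⟨(fun x => x ⟨i, Finset.mem_range.2 i.2⟩) ⁻¹' t, measurable_pi_apply _ ht, rfl⟩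
  exact h A hA

lemma infinitePi_inter_preimage_shift (μ : Measure S) [IsProbabilityMeasure μ] {n : ℕ}
    {A B : Set (ℕ → S)} (hA : MeasurableSet[obs S n] A) (hB : MeasurableSet B) :
    Measure.infinitePi (fun _ => μ) (A ∩ (fun ω k => ω (n + k)) ⁻¹' B) =
      Measure.infinitePi (fun _ => μ) A * Measure.infinitePi (fun _ => μ) B := by
  set coord : ℕ → MeasurableSpace (ℕ → S) := fun i => .comap (fun ω => ω i) inferInstance
  have hindep : ProbabilityTheory.Indep (⨆ i ∈ Iio n, coord i) (⨆ i ∈ Ici n, coord i)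
      (Measure.infinitePi fun _ => μ) :=
    ProbabilityTheory.indep_iSup_of_disjoint (fun i => (measurable_pi_apply i).comap_le)
      (ProbabilityTheory.iIndepFun_infinitePi fun _ => measurable_id).iIndep
      (Iio_disjoint_Ici le_rfl)
  have hpast : obs S n ≤ ⨆ i ∈ Iio n, coord i :=
    iSup_le fun i => le_biSup coord (mem_Iio.2 i.2)
  have hfuture : Measurable[⨆ i ∈ Ici n, coord i] fun (ω : ℕ → S) k => ω (n + k) :=
    @measurable_pi_lambda _ _ _ (_) _ _ fun k => .of_comap_le <|
      le_biSup coord (mem_Ici.2 (Nat.le_add_right n k))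
  rw [ProbabilityTheory.Indep_iff _ _ _ |>.1 hindep A _ (hpast A hA) (hfuture hB),
    ← Measure.map_apply (by fun_prop) hB,
    Measure.map_infinitePi_infinitePi_of_inj (add_right_injective n)]

lemma infinitePi_withDensity_apply {μ : Measure S} [IsProbabilityMeasure μ] {g : S → ℝ≥0∞}
    [IsProbabilityMeasure (μ.withDensity g)] (hg : Measurable g) {n : ℕ} {A : Set (ℕ → S)}
    (hA : MeasurableSet[obs S n] A) :
    Measure.infinitePi (fun _ : ℕ => μ.withDensity g) A =
      ∫⁻ ω in A, ∏ i ∈ Finset.range n, g (ω i) ∂Measure.infinitePi fun _ : ℕ => μ := by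
  obtain ⟨B, hB, rfl⟩ := exists_preimage_restrict hA
  have hrestrict : Measurable ((Finset.range n).restrict (π := fun _ : ℕ => S)) :=
    Finset.measurable_restrict _
  have hmap (ρ : Measure S) [IsProbabilityMeasure ρ] :
      (Measure.infinitePi fun _ : ℕ => ρ).map (Finset.range n).restrict =
        Measure.pi fun _ : Finset.range n => ρ := Measure.infinitePi_map_restrict _
  rw [← Measure.map_apply hrestrict hB, hmap, pi_withDensity fun _ => hg,
    withDensity_apply _ hB, ← hmap μ, setLIntegral_map hB (by fun_prop) hrestrict]
  simp only [Finset.restrict, Finset.prod_coe_sort (Finset.range n) fun _ => g _]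

end Observations
end SimpleTesting

section IID

variable {S : Type*} [MeasurableSpace S] {μ : Measure S} [IsProbabilityMeasure μ]

lemma identDistrib_eval_infinitePi (μ : Measure S) [IsProbabilityMeasure μ] (k : ℕ) :
    ProbabilityTheory.IdentDistrib (fun ω : ℕ → S => ω k) id (Measure.infinitePi fun _ => μ) μ :=
  ⟨(measurable_pi_apply k).aemeasurable, aemeasurable_id,
    by rw [Measure.map_id, Measure.infinitePi_map_eval]⟩

lemma infinitePi_sum_nonneg_le {g : S → ℝ} (hg : Measurable g)
    (hint : Integrable (fun x => Real.exp (g x)) μ) (n : ℕ) :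
    (Measure.infinitePi fun _ => μ).real {ω | 0 ≤ ∑ k ∈ Finset.range n, g (ω k)} ≤
      (∫ x, Real.exp (g x) ∂μ) ^ n := by
  have hindep : ProbabilityTheory.iIndepFun (fun (k : ℕ) (ω : ℕ → S) => g (ω k))
      (Measure.infinitePi fun _ => μ) :=
    ProbabilityTheory.iIndepFun_infinitePi fun _ => hg
  have hmeas (k : ℕ) : Measurable fun ω : ℕ → S => g (ω k) := by fun_prop
  have hdistrib (k : ℕ) := (identDistrib_eval_infinitePi μ k).comp hg.exp
  have hexp (k : ℕ) : Integrable (fun ω : ℕ → S => Real.exp (1 * g (ω k)))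
      (Measure.infinitePi fun _ => μ) := by
    simp only [one_mul]
    exact (hdistrib k).integrable_iff.2 hint
  have hmgf (k : ℕ) : ProbabilityTheory.mgf (fun ω : ℕ → S => g (ω k))
      (Measure.infinitePi fun _ => μ) 1 = ∫ x, Real.exp (g x) ∂μ := by
    simp only [ProbabilityTheory.mgf, one_mul]
    exact (hdistrib k).integral_eq
  have hmarkov := ProbabilityTheory.measure_ge_le_exp_mul_mgf 0 zero_le_one
    (hindep.integrable_exp_mul_sum hmeas (s := Finset.range n) fun k _ => hexp k)
  rw [hindep.mgf_sum hmeas] at hmarkov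
  simpa [hmgf, Finset.sum_apply] using hmarkov

lemma tendsto_infinitePi_sum_lt {g : S → ℝ} (hg : Measurable g) (hint : Integrable g μ) {c : ℝ}
    (hc : c < ∫ x, g x ∂μ) :
    Tendsto (fun n : ℕ => (Measure.infinitePi fun _ => μ).real
      {ω | ∑ k ∈ Finset.range n, g (ω k) < c * n}) atTop (𝓝 0) := by
  have hdistrib (k : ℕ) := (identDistrib_eval_infinitePi μ k).comp hg
  have hindep : ProbabilityTheory.iIndepFun (fun (k : ℕ) (ω : ℕ → S) => g (ω k))
      (Measure.infinitePi fun _ => μ) :=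
    ProbabilityTheory.iIndepFun_infinitePi fun _ => hg
  have hlln := ProbabilityTheory.strong_law_ae_real (fun (k : ℕ) (ω : ℕ → S) => g (ω k))
    ((hdistrib 0).integrable_iff.2 hint) (fun i j hij => hindep.indepFun hij)
    fun k => (hdistrib k).trans (hdistrib 0).symm
  rw [show ∫ ω : ℕ → S, g (ω 0) ∂(Measure.infinitePi fun _ => μ) = ∫ x, g x ∂μ from
    (hdistrib 0).integral_eq] at hlln
  have hconv := tendstoInMeasure_of_tendsto_ae
    (fun n => Measurable.aestronglyMeasurable (by fun_prop)) hlln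
    (ENNReal.ofReal (∫ x, g x ∂μ - c)) (by simpa using hc)
  refine squeeze_zero' (.of_forall fun _ => measureReal_nonneg) ?_
    ((ENNReal.tendsto_toReal ENNReal.zero_ne_top).comp hconv)
  filter_upwards [eventually_gt_atTop 0] with n hn
  refine measureReal_mono fun ω hω => ?_
  rw [mem_ofPred_eq, ← div_lt_iff₀ (by exact_mod_cast hn)] at hω
  rw [mem_ofPred_eq, edist_comm, edist_dist, Real.dist_eq]
  exact ENNReal.ofReal_le_ofReal ((by linarith : _ ≤ _ - _).trans (le_abs_self _))

end IID

section ExponentialMoments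

lemma le_exp_mul_sub_one_div {s : ℝ} (hs : 0 < s) (y : ℝ) : y ≤ (Real.exp (s * y) - 1) / s := by
  rw [le_div_iff₀ hs]
  linarith [Real.add_one_le_exp (s * y)]

lemma exp_mul_sub_one_div_le {s : ℝ} (hs : s ∈ Ioc (0 : ℝ) 1) (y : ℝ) :
    (Real.exp (s * y) - 1) / s ≤ Real.exp y := by
  have hconvex := convexOn_exp.2 (mem_univ y) (mem_univ 0) hs.1.le (sub_nonneg.2 hs.2) (by ring)
  simp only [smul_eq_mul, mul_zero, add_zero, Real.exp_zero, mul_one] at hconvex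
  rw [div_le_iff₀ hs.1]
  linarith [hs.1]

lemma tendsto_exp_mul_sub_one_div (y : ℝ) :
    Tendsto (fun s : ℝ => (Real.exp (s * y) - 1) / s) (𝓝[>] 0) (𝓝 y) := by
  have hderiv : HasDerivAt (fun s : ℝ => Real.exp (s * y)) y 0 := by
    simpa using ((hasDerivAt_id (0 : ℝ)).mul_const y).exp
  simpa [div_eq_inv_mul] using hderiv.tendsto_slope_zero.mono_left
    (nhdsWithin_mono 0 fun s (hs : s ∈ Ioi (0 : ℝ)) => ne_of_gt hs)

variable {Ω : Type*} [MeasurableSpace Ω] {μ : Measure Ω} {Y : Ω → ℝ}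

lemma integrable_exp_mul [IsFiniteMeasure μ] (hYm : AEMeasurable Y μ)
    (hexp : Integrable (fun x => Real.exp (Y x)) μ) {s : ℝ} (hs : s ∈ Ioc (0 : ℝ) 1) :
    Integrable (fun x => Real.exp (s * Y x)) μ := by
  refine ((hexp.const_mul s).add (integrable_const 1)).mono' (by fun_prop) (.of_forall fun x => ?_)
  have hle := exp_mul_sub_one_div_le hs (Y x)
  rw [div_le_iff₀ hs.1] at hle
  rw [Real.norm_of_nonneg (Real.exp_nonneg _), Pi.add_apply]
  linarith

lemma tendsto_integral_exp_mul_sub_one_div (hY : Integrable Y μ)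
    (hexp : Integrable (fun x => Real.exp (Y x)) μ) :
    Tendsto (fun s : ℝ => ∫ x, (Real.exp (s * Y x) - 1) / s ∂μ) (𝓝[>] 0) (𝓝 (∫ x, Y x ∂μ)) := by
  have hYm := hY.aemeasurable
  refine tendsto_integral_filter_of_dominated_convergence (fun x => |Y x| + Real.exp (Y x))
    (.of_forall fun s => by fun_prop) ?_ (hY.abs.add hexp)
    (.of_forall fun x => tendsto_exp_mul_sub_one_div (Y x))
  filter_upwards [Ioc_mem_nhdsGT (one_pos (α := ℝ))] with s hs
  refine .of_forall fun x => ?_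
  rw [Real.norm_eq_abs, abs_le]
  constructor <;> linarith [le_exp_mul_sub_one_div hs.1 (Y x), exp_mul_sub_one_div_le hs (Y x),
    neg_abs_le (Y x), abs_nonneg (Y x), Real.exp_pos (Y x)]

lemma exists_integral_exp_mul_lt_one [IsProbabilityMeasure μ] (hY : Integrable Y μ)
    (hexp : Integrable (fun x => Real.exp (Y x)) μ) (hneg : ∫ x, Y x ∂μ < 0) :
    ∃ s > 0, Integrable (fun x => Real.exp (s * Y x)) μ ∧ ∫ x, Real.exp (s * Y x) ∂μ < 1 := by
  obtain ⟨s, hs, hlt⟩ := (Filter.Eventually.and (Ioc_mem_nhdsGT one_pos)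
    ((tendsto_integral_exp_mul_sub_one_div hY hexp).eventually_lt_const hneg)).exists
  have hint := integrable_exp_mul hY.aemeasurable hexp hs
  refine ⟨s, hs.1, hint, ?_⟩
  rw [integral_div, integral_sub hint (integrable_const 1), div_lt_iff₀ hs.1, zero_mul,
    integral_const, probReal_univ, one_smul] at hlt
  linarith

lemma integrable_and_integral_eq_one_of_withDensity (hY : Measurable Y) (hY0 : ∀ x, 0 ≤ Y x)
    [IsProbabilityMeasure (μ.withDensity fun x => ENNReal.ofReal (Y x))] :
    Integrable Y μ ∧ ∫ x, Y x ∂μ = 1 := by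
  have hone : ∫⁻ x, ENNReal.ofReal (Y x) ∂μ = 1 := by
    rw [← setLIntegral_univ, ← withDensity_apply _ .univ, measure_univ]
  refine ⟨⟨by fun_prop, ?_⟩, ?_⟩
  · rw [hasFiniteIntegral_iff_ofReal (.of_forall hY0), hone]
    exact ENNReal.one_lt_top
  · rw [integral_eq_lintegral_of_nonneg_ae (.of_forall hY0) (by fun_prop), hone, ENNReal.toReal_one]

end ExponentialMoments

namespace SimpleTesting

/-! ### Likelihood ratios and change of measure -/

section Likelihood

variable {S : Type*} [MeasurableSpace S] (H : SimpleTesting S)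

instance isProbabilityMeasure_P (i : Fin 2) : IsProbabilityMeasure (H.P i) := by
  unfold P; infer_instance

/-- The log-likelihood ratio `log (f 1 / f 0)` of one observation. It takes a junk value where one
of the densities vanishes, which happens with probability zero when the two laws are mutually
absolutely continuous. -/
noncomputable def logRatio (x : S) : ℝ := Real.log (H.f 1 x / H.f 0 x)

@[fun_prop]
lemma measurable_logRatio : Measurable H.logRatio :=
  ((H.measurable_f 1).div (H.measurable_f 0)).log

lemma llr_eq_sum (n : ℕ) (ω : ℕ → S) : H.llr n ω = ∑ k ∈ Finset.range n, H.logRatio (ω k) := rfl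

lemma llr_add (m n : ℕ) (ω : ℕ → S) :
    H.llr (m + n) ω = H.llr m ω + H.llr n fun k => ω (m + k) := by
  simp only [llr, Finset.sum_range_add]

lemma measurable_llr_obs (n : ℕ) : Measurable[obs S n] (H.llr n) :=
  Finset.measurable_fun_sum _ fun _ hi =>
    H.measurable_logRatio.comp (measurable_obs_apply (Finset.mem_range.1 hi))

lemma measurable_avgLlr_obs (n : ℕ) : Measurable[obs S n] (H.avgLlr n) :=
  (H.measurable_llr_obs n).div_const _

lemma measurable_avgLlr (n : ℕ) : Measurable (H.avgLlr n) :=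
  (H.measurable_avgLlr_obs n).mono (obs_le n) le_rfl

lemma ae_law_pos (i : Fin 2) : ∀ᵐ x ∂(H.law i), 0 < H.f i x := by
  rw [law, ae_withDensity_iff (H.measurable_f i).ennreal_ofReal]
  exact .of_forall fun x hx => by simpa using hx

variable {H}

lemma law_eq_withDensity {i j : Fin 2} (h : H.law i ≪ H.law j) :
    H.law i = (H.law j).withDensity fun x => ENNReal.ofReal (H.f i x / H.f j x) := by
  have hi := H.measurable_f i
  have hj := H.measurable_f j
  have hpos : ∀ᵐ x ∂(H.law i), 0 < H.f j x := h.ae_le (H.ae_law_pos j)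
  rw [law, ae_withDensity_iff hi.ennreal_ofReal] at hpos
  conv_rhs => rw [law]
  rw [← withDensity_mul _ (by fun_prop) (by fun_prop), law]
  refine withDensity_congr_ae ?_
  filter_upwards [hpos] with x hx
  rw [Pi.mul_apply, ← ENNReal.ofReal_mul (H.f_nonneg j x)]
  rcases (H.f_nonneg i x).eq_or_lt with hzero | hfi
  · simp [← hzero]
  · rw [mul_div_cancel₀ _ (hx (by simpa using hfi)).ne']

variable (H) in
/-- The hypotheses under which the tests are analyzed: the null has positive and finite
Kullback-Leibler divergence from the alternative, whose law is absolutely continuous with respect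
to that of the null. -/
structure Regular : Prop where
  kl_zero_pos : 0 < H.kl 0
  kl_zero_lt_top : H.kl 0 < ∞
  law_one_ac : H.law 1 ≪ H.law 0

lemma Regular.I_pos (hH : H.Regular) : 0 < H.I 0 :=
  ENNReal.toReal_pos hH.kl_zero_pos.ne' hH.kl_zero_lt_top.ne

lemma Regular.law_zero_ac (hH : H.Regular) : H.law 0 ≪ H.law 1 :=
  (InformationTheory.klDiv_ne_top_iff.1 hH.kl_zero_lt_top.ne).1

lemma Regular.law_zero_eq (hH : H.Regular) :
    H.law 0 = (H.law 1).withDensity fun x => ENNReal.ofReal (Real.exp (-H.logRatio x)) := by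
  rw [law_eq_withDensity hH.law_zero_ac]
  refine withDensity_congr_ae ?_
  filter_upwards [H.ae_law_pos 1, hH.law_one_ac.ae_le (H.ae_law_pos 0)] with x h1 h0
  rw [logRatio, Real.exp_neg, Real.exp_log (div_pos h1 h0), inv_div]

lemma Regular.law_one_eq (hH : H.Regular) :
    H.law 1 = (H.law 0).withDensity fun x => ENNReal.ofReal (Real.exp (H.logRatio x)) := by
  rw [law_eq_withDensity hH.law_one_ac]
  refine withDensity_congr_ae ?_
  filter_upwards [H.ae_law_pos 0, hH.law_zero_ac.ae_le (H.ae_law_pos 1)] with x h0 h1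
  rw [logRatio, Real.exp_log (div_pos h1 h0)]

lemma Regular.llr_law_ae_eq (hH : H.Regular) :
    MeasureTheory.llr (H.law 0) (H.law 1) =ᵐ[H.law 0] fun x => -H.logRatio x := by
  have hderiv := hH.law_zero_ac.ae_le (Measure.rnDeriv_withDensity (H.law 1)
    (f := fun x => ENNReal.ofReal (Real.exp (-H.logRatio x))) (by fun_prop))
  rw [← hH.law_zero_eq] at hderiv
  filter_upwards [hderiv] with x hx
  rw [MeasureTheory.llr, hx, ENNReal.toReal_ofReal (Real.exp_nonneg _), Real.log_exp]

lemma Regular.integrable_logRatio (hH : H.Regular) : Integrable H.logRatio (H.law 0) := by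
  have hint := (InformationTheory.klDiv_ne_top_iff.1 hH.kl_zero_lt_top.ne).2
  simpa using (hint.congr hH.llr_law_ae_eq).neg

lemma Regular.integral_logRatio (hH : H.Regular) : ∫ x, H.logRatio x ∂(H.law 0) = -H.I 0 := by
  rw [I, kl, sub_zero,
    InformationTheory.toReal_klDiv_of_measure_eq hH.law_zero_ac (by simp only [measure_univ]),
    integral_congr_ae hH.llr_law_ae_eq, integral_neg, neg_neg]

lemma Regular.P_zero_inter_le_llr_le (hH : H.Regular) {n : ℕ} {A : Set (ℕ → S)}
    (hA : MeasurableSet[obs S n] A) (t : ℝ) :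
    (H.P 0).real (A ∩ {ω | -t ≤ H.llr n ω}) ≤ Real.exp t * (H.P 1).real A := by
  have hB : MeasurableSet[obs S n] {ω | -t ≤ H.llr n ω} :=
    H.measurable_llr_obs n measurableSet_Ici
  have hprob : IsProbabilityMeasure
      ((H.law 1).withDensity fun x => ENNReal.ofReal (Real.exp (-H.logRatio x))) := by
    rw [← hH.law_zero_eq]; infer_instance
  have hle : H.P 0 (A ∩ {ω | -t ≤ H.llr n ω}) ≤ ENNReal.ofReal (Real.exp t) * H.P 1 A := by
    rw [P, hH.law_zero_eq, infinitePi_withDensity_apply (by fun_prop) (MeasurableSet.inter hA hB)]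
    calc _ ≤ ∫⁻ _ in A ∩ {ω | -t ≤ H.llr n ω}, ENNReal.ofReal (Real.exp t) ∂(H.P 1) := by
          refine setLIntegral_mono measurable_const fun _ hω => ?_
          rw [← ENNReal.ofReal_prod_of_nonneg fun _ _ => Real.exp_nonneg _, ← Real.exp_sum,
            Finset.sum_neg_distrib, ← llr_eq_sum]
          exact ENNReal.ofReal_le_ofReal (Real.exp_le_exp.2 (neg_le.1 hω.2))
      _ = ENNReal.ofReal (Real.exp t) * H.P 1 (A ∩ {ω | -t ≤ H.llr n ω}) := setLIntegral_const _ _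
      _ ≤ _ := by gcongr; exact inter_subset_left
  rw [Measure.real, Measure.real, ← ENNReal.toReal_ofReal (Real.exp_nonneg t),
    ← ENNReal.toReal_mul]
  exact ENNReal.toReal_mono (ENNReal.mul_ne_top (by simp) (by finiteness)) hle

end Likelihood

/-! ### Tail bounds for the log-likelihood ratio -/

section Tails

variable {S : Type*} [MeasurableSpace S] {H : SimpleTesting S}

lemma Regular.P_one_avgLlr_le (hH : H.Regular) (n : ℕ) (c : ℝ) :
    (H.P 1).real {ω | H.avgLlr n ω ≤ c} ≤ Real.exp (c * n) := by
  rcases Nat.eq_zero_or_pos n with rfl | hn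
  · simp
  have hprob : IsProbabilityMeasure
      ((H.law 1).withDensity fun x => ENNReal.ofReal (Real.exp (-H.logRatio x))) := by
    rw [← hH.law_zero_eq]; infer_instance
  obtain ⟨hint, hone⟩ := integrable_and_integral_eq_one_of_withDensity (μ := H.law 1)
    (Y := fun x => Real.exp (-H.logRatio x)) (by fun_prop) fun _ => Real.exp_nonneg _
  have hexp (x : S) : Real.exp (c - H.logRatio x) = Real.exp c * Real.exp (-H.logRatio x) := by
    rw [← Real.exp_add, sub_eq_add_neg]
  have hchernoff := infinitePi_sum_nonneg_le (μ := H.law 1) (g := fun x => c - H.logRatio x)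
    (by fun_prop) (by simpa only [hexp] using hint.const_mul _) n
  simp only [hexp, integral_const_mul, hone, mul_one, ← Real.exp_nat_mul] at hchernoff
  rw [mul_comm c]
  refine le_trans (measureReal_mono fun ω hω => ?_) hchernoff
  rw [mem_ofPred_eq, avgLlr, div_le_iff₀ (by positivity), llr_eq_sum] at hω
  simp only [mem_ofPred_eq, Finset.sum_sub_distrib, Finset.sum_const, Finset.card_range,
    nsmul_eq_mul]
  linarith

lemma Regular.exists_P_zero_lt_avgLlr_le (hH : H.Regular) {c : ℝ} (hc : -H.I 0 < c) :
    ∃ ρ > 0, ∀ n : ℕ, (H.P 0).real {ω | c < H.avgLlr n ω} ≤ Real.exp (-(ρ * n)) := by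
  have hprob : IsProbabilityMeasure
      ((H.law 0).withDensity fun x => ENNReal.ofReal (Real.exp (H.logRatio x))) := by
    rw [← hH.law_one_eq]; infer_instance
  obtain ⟨hexp, -⟩ := integrable_and_integral_eq_one_of_withDensity (μ := H.law 0)
    (Y := fun x => Real.exp (H.logRatio x)) (by fun_prop) fun _ => Real.exp_nonneg _
  obtain ⟨s, hs, hint, hlt⟩ := exists_integral_exp_mul_lt_one (μ := H.law 0)
    (Y := fun x => H.logRatio x - c) (hH.integrable_logRatio.sub (integrable_const _))
    (by simpa only [Real.exp_sub] using hexp.div_const _)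
    (by rw [integral_sub hH.integrable_logRatio (integrable_const _), hH.integral_logRatio,
          integral_const, probReal_univ, one_smul]; linarith)
  set q := ∫ x, Real.exp (s * (H.logRatio x - c)) ∂(H.law 0)
  have hq : 0 < q := integral_exp_pos hint
  refine ⟨-Real.log q, neg_pos.2 (Real.log_neg hq hlt), fun n => ?_⟩
  rcases Nat.eq_zero_or_pos n with rfl | hn
  · simp
  rw [neg_mul, neg_neg, mul_comm, Real.exp_nat_mul, Real.exp_log hq]
  refine le_trans (measureReal_mono fun ω hω => ?_) (infinitePi_sum_nonneg_le (by fun_prop) hint n)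
  rw [mem_ofPred_eq, avgLlr, lt_div_iff₀ (by positivity), llr_eq_sum] at hω
  simp only [mem_ofPred_eq, ← Finset.mul_sum, Finset.sum_sub_distrib, Finset.sum_const,
    Finset.card_range, nsmul_eq_mul]
  exact mul_nonneg hs.le (by linarith)

lemma Regular.tendsto_P_zero_llr_lt (hH : H.Regular) {c : ℝ} (hc : c < -H.I 0) :
    Tendsto (fun n : ℕ => (H.P 0).real {ω | H.llr n ω < c * n}) atTop (𝓝 0) :=
  tendsto_infinitePi_sum_lt H.measurable_logRatio hH.integrable_logRatio
    (hH.integral_logRatio ▸ hc)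

end Tails
end SimpleTesting

section Thresholds

variable {Ω : Type*} [MeasurableSpace Ω] {μ : Measure Ω} {X : Ω → ℝ} {a : ℝ}

lemma measureReal_lt_inter_le_of_tendsto [IsFiniteMeasure μ] {A : Set Ω} {u : ℕ → EReal}
    {b : EReal} (hu : Antitone u) (hlim : Tendsto u atTop (𝓝 b))
    (h : ∀ n, μ.real ({ω | u n < (X ω : EReal)} ∩ A) ≤ a) :
    μ.real ({ω | b < (X ω : EReal)} ∩ A) ≤ a := by
  have hunion : {ω | b < (X ω : EReal)} ∩ A = ⋃ n, {ω | u n < (X ω : EReal)} ∩ A := by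
    rw [← iUnion_inter]
    congr 1
    ext ω
    simp only [mem_ofPred_eq, mem_iUnion]
    exact ⟨fun hω => (hlim.eventually_lt_const hω).exists,
      fun ⟨n, hn⟩ => (hu.le_of_tendsto hlim n).trans_lt hn⟩
  have hmono : Monotone fun n => {ω | u n < (X ω : EReal)} ∩ A := fun m n hmn =>
    inter_subset_inter_left _ fun ω hω => (hu hmn).trans_lt hω
  have htendsto := (ENNReal.continuousAt_toReal (measure_ne_top μ _)).tendsto.comp
    (tendsto_measure_iUnion_atTop (μ := μ) hmono)
  rw [hunion]
  exact le_of_tendsto htendsto (.of_forall h)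

lemma bddBelow_setOf_measureReal_lt_le [IsProbabilityMeasure μ] (ha : a < 1) :
    BddBelow {c : ℝ | μ.real {ω | c < X ω} ≤ a} := by
  by_contra hbdd
  obtain ⟨u, hu, hlim, hmem⟩ : ∃ u : ℕ → ℝ, Antitone u ∧ Tendsto u atTop atBot ∧
      ∀ n, μ.real {ω | u n < X ω} ≤ a := by
    refine ⟨fun n => -(n : ℝ), fun m n hmn => neg_le_neg (Nat.cast_le.2 hmn),
      tendsto_neg_atTop_atBot.comp tendsto_natCast_atTop_atTop, fun n => ?_⟩
    obtain ⟨c, hc, hcn⟩ := not_bddBelow_iff.1 hbdd (-(n : ℝ))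
    exact (measureReal_mono fun ω hω => hcn.trans hω).trans hc
  have hle := measureReal_lt_inter_le_of_tendsto (μ := μ) (X := X) (A := univ) (a := a)
    (u := fun n => (u n : EReal)) (b := ⊥) (fun m n hmn => EReal.coe_le_coe (hu hmn))
    (EReal.tendsto_coe_nhds_bot_iff.2 hlim) (by simpa using hmem)
  simp only [EReal.bot_lt_coe, ofPred_true, inter_univ, probReal_univ] at hle
  exact absurd hle (not_le.2 ha)

end Thresholds

namespace SimpleTesting

/-! ### Sample sizes that are sufficient for given error levels -/

section Sufficient

variable {S : Type*} [MeasurableSpace S] (H : SimpleTesting S)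

/-- The test that rejects the null when `avgLlr n` exceeds `c` has error probabilities at most `a`
and `δ`. -/
def ErrorsLE (n : ℕ) (c a δ : ℝ) : Prop :=
  (H.P 0).real {ω | c < H.avgLlr n ω} ≤ a ∧ (H.P 1).real {ω | H.avgLlr n ω ≤ c} ≤ δ

variable {H}

lemma Regular.exists_errorsLE (hH : H.Regular) {κ : ℝ} (hκ : κ < H.I 0) :
    ∃ ρ > 0, ∃ c : ℝ, ∀ (n : ℕ) (a δ : ℝ), 0 < a → 0 < δ → -Real.log a ≤ ρ * n →
      -Real.log δ ≤ κ * n → H.ErrorsLE n c a δ := by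
  obtain ⟨ρ, hρ, hnull⟩ := hH.exists_P_zero_lt_avgLlr_le (neg_lt_neg hκ)
  refine ⟨ρ, hρ, -κ, fun n a δ ha hδ han hδn => ⟨(hnull n).trans ?_,
    (hH.P_one_avgLlr_le n (-κ)).trans ?_⟩⟩
  · rw [← Real.le_log_iff_exp_le ha]
    linarith
  · rw [← Real.le_log_iff_exp_le hδ]
    linarith

lemma Regular.exists_eventually_errorsLE (hH : H.Regular) {a δ : ℝ} (ha : 0 < a) (hδ : 0 < δ) :
    ∃ c, ∀ᶠ n : ℕ in atTop, H.ErrorsLE n c a δ := by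
  obtain ⟨ρ, hρ, c, h⟩ := hH.exists_errorsLE (half_lt_self hH.I_pos)
  have hlarge {κ : ℝ} (hκ : 0 < κ) (t : ℝ) : ∀ᶠ n : ℕ in atTop, t ≤ κ * n :=
    (tendsto_natCast_atTop_atTop.const_mul_atTop hκ).eventually_ge_atTop t
  refine ⟨c, ?_⟩
  filter_upwards [hlarge hρ _, hlarge (half_pos hH.I_pos) _] with n han hδn
  exact h n a δ ha hδ han hδn

lemma Regular.nStar_spec (hH : H.Regular) {a δ : ℝ} (ha : 0 < a) (hδ : 0 < δ) :
    1 ≤ H.nStar a δ ∧ ∃ c, H.ErrorsLE (H.nStar a δ) c a δ := by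
  obtain ⟨c, hc⟩ := hH.exists_eventually_errorsLE ha hδ
  obtain ⟨n, hn, hpos⟩ := (hc.and (eventually_ge_atTop 1)).exists
  exact Nat.sInf_mem (s := {n | 1 ≤ n ∧ ∃ c, H.ErrorsLE n c a δ}) ⟨n, hpos, c, hn⟩

lemma ErrorsLE.nStar_le {n : ℕ} {c a δ : ℝ} (h : H.ErrorsLE n c a δ) (hn : 1 ≤ n) :
    H.nStar a δ ≤ n :=
  Nat.sInf_le ⟨hn, c, h⟩

lemma Regular.cStar_spec (hH : H.Regular) {a δ : ℝ} (ha : a ∈ Ioo (0 : ℝ) 1) (hδ : 0 < δ) :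
    H.ErrorsLE (H.nStar a δ) (H.cStar a δ) a δ := by
  set T : Set ℝ := {c | H.ErrorsLE (H.nStar a δ) c a δ}
  obtain ⟨c, hc⟩ : T.Nonempty := (hH.nStar_spec ha.1 hδ).2
  have hbdd : BddBelow T := (bddBelow_setOf_measureReal_lt_le (μ := H.P 0) ha.2).mono fun _ h => h.1
  change H.ErrorsLE _ (sInf T) a δ
  refine ⟨?_, le_trans (measureReal_mono fun ω hω => le_trans hω (csInf_le hbdd hc)) hc.2⟩
  obtain ⟨u, hu, hlim, huT⟩ := exists_seq_tendsto_sInf ⟨c, hc⟩ hbdd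
  simpa using measureReal_lt_inter_le_of_tendsto (μ := H.P 0) (X := H.avgLlr (H.nStar a δ))
    (A := univ) (a := a) (u := fun k => (u k : EReal)) (b := (sInf T : ℝ))
    (fun k l h => EReal.coe_le_coe (hu h)) ((continuous_coe_real_ereal.tendsto _).comp hlim)
    fun k => by simpa using (huT k).1

lemma sInf_modThresholds_spec {A : Set (ℕ → S)} {N : ℕ} {a δ : ℝ}
    (hne : (H.modThresholds A N a δ).Nonempty) :
    (H.P 0).real ({ω | sInf ((fun b : ℝ => (b : EReal)) '' H.modThresholds A N a δ) <
        (H.avgLlr N ω : EReal)} ∩ A) ≤ a ∧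
      (H.P 1).real {ω | (H.avgLlr N ω : EReal) ≤
        sInf ((fun b : ℝ => (b : EReal)) '' H.modThresholds A N a δ)} ≤ δ := by
  constructor
  · obtain ⟨u, hu, hlim, huT⟩ := exists_seq_tendsto_sInf
      (hne.image fun b : ℝ => (b : EReal)) (OrderBot.bddBelow _)
    refine measureReal_lt_inter_le_of_tendsto hu hlim fun k => ?_
    obtain ⟨b, hb, hbu⟩ := huT k
    simpa only [← hbu, EReal.coe_lt_coe_iff] using hb.1
  · obtain ⟨c, hc⟩ := hne
    refine le_trans (measureReal_mono fun ω hω => ?_) hc.2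
    exact EReal.coe_le_coe_iff.1 (le_trans hω (sInf_le ⟨c, hc, rfl⟩))

end Sufficient

/-! ### Sample sizes that are necessary for given error levels -/

section Necessary

variable {S : Type*} [MeasurableSpace S] (H : SimpleTesting S)

/-- An event determined by at most `(1 - ε) |log δ| / I 0` observations that has probability at
most `δ` under the alternative has probability at most `ε` under the null. -/
def ConverseAt (ε δ : ℝ) : Prop :=
  ∀ N : ℕ, N * H.I 0 ≤ (1 - ε) * -Real.log δ →
    ∀ A, MeasurableSet[obs S N] A → (H.P 1).real A ≤ δ → (H.P 0).real A ≤ ε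

variable {H}

lemma Regular.P_zero_le_add (hH : H.Regular) {n : ℕ} {A : Set (ℕ → S)}
    (hA : MeasurableSet[obs S n] A) (t : ℝ) :
    (H.P 0).real A ≤ Real.exp t * (H.P 1).real A + (H.P 0).real {ω | H.llr n ω < -t} :=
  calc (H.P 0).real A
      ≤ (H.P 0).real ((A ∩ {ω | -t ≤ H.llr n ω}) ∪ {ω | H.llr n ω < -t}) :=
        measureReal_mono fun ω hω => (le_or_gt (-t) (H.llr n ω)).imp_left fun h => ⟨hω, h⟩
    _ ≤ _ := measureReal_union_le _ _
    _ ≤ _ := by gcongr; exact hH.P_zero_inter_le_llr_le hA t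

lemma tendsto_neg_log_nhdsGT_zero : Tendsto (fun δ : ℝ => -Real.log δ) (𝓝[>] 0) atTop :=
  tendsto_neg_atBot_atTop.comp Real.tendsto_log_nhdsGT_zero

lemma Regular.eventually_converseAt (hH : H.Regular) {ε : ℝ} (hε : ε ∈ Ioo (0 : ℝ) 1) :
    ∀ᶠ δ in 𝓝[>] (0 : ℝ), H.ConverseAt ε δ := by
  have hI := hH.I_pos
  obtain ⟨hε0, hε1⟩ := hε
  let n : ℝ → ℕ := fun δ => ⌊(1 - ε) * -Real.log δ / H.I 0⌋₊
  have hn : Tendsto n (𝓝[>] 0) atTop := tendsto_nat_floor_atTop.comp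
    ((tendsto_neg_log_nhdsGT_zero.const_mul_atTop (sub_pos.2 hε1)).atTop_div_const hI)
  have hlln := hn.eventually ((hH.tendsto_P_zero_llr_lt
    (c := -((1 + ε) * H.I 0)) (by nlinarith)).eventually_lt_const (half_pos hε0))
  have hexp : ∀ᶠ δ in 𝓝[>] (0 : ℝ), Real.exp (-(ε ^ 2 * -Real.log δ)) < ε / 2 :=
    (Real.tendsto_exp_neg_atTop_nhds_zero.comp
      (tendsto_neg_log_nhdsGT_zero.const_mul_atTop (pow_pos hε0 2))).eventually_lt_const
        (half_pos hε0)
  filter_upwards [hlln, hexp, Ioo_mem_nhdsGT one_pos] with δ hllnδ hexpδ hδ N hN A hA hA1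
  have hNn : N ≤ n δ := Nat.le_floor ((le_div_iff₀ hI).2 hN)
  have hnle : (n δ : ℝ) * H.I 0 ≤ (1 - ε) * -Real.log δ :=
    (le_div_iff₀ hI).1 (Nat.floor_le (div_nonneg (mul_nonneg (sub_pos.2 hε1).le
      (neg_pos.2 (Real.log_neg hδ.1 hδ.2)).le) hI.le))
  -- This `t` leaves room on both sides: `exp t * δ = δ ^ ε²` and `(1 + ε) I₀ n ≤ t`.
  set t := (1 - ε ^ 2) * -Real.log δ with ht
  have hfirst : Real.exp t * (H.P 1).real A ≤ ε / 2 :=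
    calc _ ≤ Real.exp t * δ := by gcongr
      _ = Real.exp (-(ε ^ 2 * -Real.log δ)) := by
        nth_rewrite 1 [← Real.exp_log hδ.1]
        rw [← Real.exp_add, ht]
        ring_nf
      _ ≤ _ := hexpδ.le
  have hsecond : (H.P 0).real {ω | H.llr (n δ) ω < -t} ≤ ε / 2 := by
    have hnt : -t ≤ -((1 + ε) * H.I 0) * n δ := by nlinarith
    exact le_trans (measureReal_mono fun ω hω => lt_of_lt_of_le hω hnt) hllnδ.le
  linarith [hH.P_zero_le_add (obs_mono hNn A hA) t]

lemma IsTest.measurableSet_le {T : (ℕ → S) → ℕ∞} {D : (ℕ → S) → Fin 2} (h : H.IsTest T D)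
    (N : ℕ) (i : Fin 2) : MeasurableSet[obs S N] {ω | T ω ≤ N ∧ D ω = i} := by
  have hunion : {ω | T ω ≤ N ∧ D ω = i} = ⋃ n ∈ Finset.Icc 1 N, {ω | T ω = n ∧ D ω = i} := by
    ext ω
    simp only [mem_ofPred_eq, mem_iUnion, Finset.mem_Icc, exists_prop]
    constructor
    · rintro ⟨hle, hD⟩
      obtain ⟨n, hn⟩ := ENat.ne_top_iff_exists.1 (ne_top_of_le_ne_top (ENat.natCast_ne_top N) hle)
      have hone := h.one_le ω
      rw [← hn] at hle hone
      exact ⟨n, ⟨by exact_mod_cast hone, by exact_mod_cast hle⟩, hn.symm, hD⟩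
    · rintro ⟨n, hn, hT, hD⟩
      exact ⟨by rw [hT]; exact_mod_cast hn.2, hD⟩
  rw [hunion]
  refine Finset.measurableSet_biUnion _ fun n hn => ?_
  rw [Finset.mem_Icc] at hn
  exact obs_mono hn.2 _ (h.decision n hn.1 i)

lemma IsTest.le_ess {T : (ℕ → S) → ℕ∞} {D : (ℕ → S) → Fin 2} (h : H.IsTest T D) (N : ℕ)
    (i : Fin 2) :
    ENNReal.ofReal ((N + 1) * (1 - (H.P i).real {ω | T ω ≤ N ∧ D ω = 0} -
      (H.P i).real {ω | D ω = 1})) ≤ H.ess i T := by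
  have hAm := obs_le _ _ (h.measurableSet_le N 0)
  have hDm : MeasurableSet {ω | D ω = 1} := h.measurable_decision (measurableSet_singleton 1)
  set E := ({ω | T ω ≤ N ∧ D ω = 0} ∪ {ω | D ω = 1})ᶜ with hE
  have hEm : MeasurableSet E := (hAm.union hDm).compl
  have hlt {ω : ℕ → S} (hω : ω ∈ E) : ((N + 1 : ℕ) : ℝ≥0∞) ≤ (T ω : ℝ≥0∞) := by
    simp only [hE, mem_compl_iff, mem_union, mem_ofPred_eq, not_or, not_and] at hω
    have hTN : (N : ℕ∞) < T ω := not_le.1 fun hle => hω.1 hle (by have := hω.2; omega)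
    simpa using ENat.toENNReal_le.2 (Order.add_one_le_of_lt hTN)
  calc _ ≤ ENNReal.ofReal ((N + 1) * (H.P i).real E) := by
        have hunion := measureReal_union_le (μ := H.P i) {ω | T ω ≤ N ∧ D ω = 0} {ω | D ω = 1}
        gcongr
        rw [hE, probReal_compl_eq_one_sub (hAm.union hDm)]
        linarith
    _ = ((N + 1 : ℕ) : ℝ≥0∞) * H.P i E := by
        rw [ENNReal.ofReal_mul (by positivity), ofReal_measureReal, ← Nat.cast_add_one,
          ENNReal.ofReal_natCast]
    _ = ∫⁻ _ in E, ((N + 1 : ℕ) : ℝ≥0∞) ∂(H.P i) := (setLIntegral_const _ _).symm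
    _ ≤ ∫⁻ ω in E, (T ω : ℝ≥0∞) ∂(H.P i) := setLIntegral_mono' hEm fun _ => hlt
    _ ≤ H.ess i T := setLIntegral_le_lintegral _ _

lemma ConverseAt.le_optEss {ε α β : ℝ} (h : H.ConverseAt ε β) (hI : 0 < H.I 0) (hε : ε ≤ 1 / 2)
    (hα : α ≤ ε) (hβ : β ∈ Ioo (0 : ℝ) 1) :
    ENNReal.ofReal ((1 - 2 * ε) * ((1 - ε) * (-Real.log β / H.I 0))) ≤ H.optEss 0 α β := by
  refine le_iInf₂ fun χ ⟨htest, h0, h1⟩ => le_trans ?_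
    (htest.le_ess ⌊(1 - ε) * -Real.log β / H.I 0⌋₊ 0)
  have hL : 0 < -Real.log β := neg_pos.2 (Real.log_neg hβ.1 hβ.2)
  have hpos : 0 ≤ (1 - ε) * -Real.log β / H.I 0 :=
    div_nonneg (mul_nonneg (by linarith) hL.le) hI.le
  have hA := h _ ((le_div_iff₀ hI).1 (Nat.floor_le hpos)) _ (htest.measurableSet_le _ 0)
    ((measureReal_mono fun ω hω => hω.2).trans h1)
  rw [mul_comm, ← mul_div_assoc]
  exact ENNReal.ofReal_le_ofReal (mul_le_mul (Nat.lt_floor_add_one _).le (by linarith)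
    (by linarith) (by positivity))

lemma ConverseAt.lt_nStar {ε a δ : ℝ} (h : H.ConverseAt ε δ) (hH : H.Regular) (ha : 0 < a)
    (haε : a < 1 - ε) (hδ : 0 < δ) :
    (1 - ε) * (-Real.log δ / H.I 0) < H.nStar a δ := by
  rw [← mul_div_assoc, div_lt_iff₀ hH.I_pos]
  by_contra! hle
  obtain ⟨-, c, h0, h1⟩ := hH.nStar_spec ha hδ
  have hacc := h _ hle {ω | H.avgLlr (H.nStar a δ) ω ≤ c}
    (H.measurable_avgLlr_obs _ measurableSet_Iic) h1
  have hcompl : {ω | c < H.avgLlr (H.nStar a δ) ω} = {ω | H.avgLlr (H.nStar a δ) ω ≤ c}ᶜ := by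
    ext ω
    simp
  rw [hcompl, probReal_compl_eq_one_sub
    (measurableSet_le (H.measurable_avgLlr _) measurable_const)] at h0
  linarith

end Necessary
end SimpleTesting

namespace SimpleTesting

/-! ### Tests in stages -/

section Stages

variable {S : Type*} {K : ℕ} {M : ℕ → ℕ} {stat : ℕ → (ℕ → S) → ℝ} {b : ℕ → EReal}

/-- The event that the thresholds are exceeded at the stages `1, …, j`. -/
def passedAll (stat : ℕ → (ℕ → S) → ℝ) (b : ℕ → EReal) (j : ℕ) : Set (ℕ → S) :=
  {ω | ∀ i ∈ Finset.Icc 1 j, b i < (stat i ω : EReal)}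

lemma lastStage_spec (hK : 1 ≤ K) (ω : ℕ → S) :
    1 ≤ lastStage K stat b ω ∧
      (lastStage K stat b ω = K ∨ (stat (lastStage K stat b ω) ω : EReal) ≤
        b (lastStage K stat b ω)) :=
  Nat.sInf_mem (s := {j | 1 ≤ j ∧ (j = K ∨ (stat j ω : EReal) ≤ b j)}) ⟨K, hK, Or.inl rfl⟩

lemma lastStage_le {j : ℕ} {ω : ℕ → S} (hj : 1 ≤ j) (h : j = K ∨ (stat j ω : EReal) ≤ b j) :
    lastStage K stat b ω ≤ j :=
  Nat.sInf_le ⟨hj, h⟩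

lemma lastStage_mem_Icc (hK : 1 ≤ K) (ω : ℕ → S) : lastStage K stat b ω ∈ Icc 1 K :=
  ⟨(lastStage_spec hK ω).1, lastStage_le hK (Or.inl rfl)⟩

lemma mem_passedAll_of_lt_lastStage {j : ℕ} {ω : ℕ → S} (h : j < lastStage K stat b ω) :
    ω ∈ passedAll stat b j := fun i hi => by
  rw [Finset.mem_Icc] at hi
  by_contra! hle
  exact (lastStage_le (K := K) hi.1 (Or.inr hle)).not_gt (hi.2.trans_lt h)

lemma lastStage_eq_of_mem_passedAll (hK : 1 ≤ K) {ω : ℕ → S} (h : ω ∈ passedAll stat b K) :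
    lastStage K stat b ω = K :=
  (lastStage_spec hK ω).2.resolve_right
    (not_le.2 (h _ (Finset.mem_Icc.2 (lastStage_mem_Icc hK ω))))

lemma lastStage_eq_iff {j : ℕ} (hj : j ∈ Icc 1 K) (ω : ℕ → S) :
    lastStage K stat b ω = j ↔
      ω ∈ passedAll stat b (j - 1) ∧ (j = K ∨ (stat j ω : EReal) ≤ b j) := by
  have hK : 1 ≤ K := hj.1.trans hj.2
  have hmem := lastStage_mem_Icc (stat := stat) (b := b) hK ω
  constructor
  · rintro rfl
    exact ⟨mem_passedAll_of_lt_lastStage (K := K) (by have := hj.1; omega),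
      (lastStage_spec hK ω).2⟩
  · rintro ⟨hpass, hbelow⟩
    refine le_antisymm (lastStage_le hj.1 hbelow) (not_lt.1 fun hlt => ?_)
    rcases (lastStage_spec (stat := stat) (b := b) hK ω).2 with hlast | hle
    · exact hj.2.not_gt (hlast ▸ hlt)
    · exact (hpass _ (Finset.mem_Icc.2 ⟨hmem.1, by omega⟩)).not_ge hle

lemma stagedTest_snd_eq_one_iff (ω : ℕ → S) :
    (stagedTest K M stat b).2 ω = 1 ↔ ω ∈ passedAll stat b K := by
  simp [stagedTest, passedAll]

lemma stagedTest_snd_eq_zero_iff (ω : ℕ → S) :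
    (stagedTest K M stat b).2 ω = 0 ↔ ω ∉ passedAll stat b K := by
  simp [stagedTest, passedAll]

end Stages

section AdaptedStages

variable {S : Type*} [MeasurableSpace S] {H : SimpleTesting S} {K : ℕ} {M : ℕ → ℕ}
  {stat : ℕ → (ℕ → S) → ℝ} {b : ℕ → EReal}

/-- The stages `1, …, K` can be carried out one after the other: stage `j` ends after `M j ≥ 1`
observations in total, no fewer than the stage before, and its statistic depends only on these. -/
structure Adapted (K : ℕ) (M : ℕ → ℕ) (stat : ℕ → (ℕ → S) → ℝ) : Prop where
  one_le : 1 ≤ K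
  one_le_size : 1 ≤ M 1
  monotoneOn : MonotoneOn M (Icc 1 K)
  measurable : ∀ j ∈ Icc 1 K, Measurable[obs S (M j)] (stat j)

namespace Adapted

lemma measurableSet_lt (h : Adapted K M stat) {j : ℕ} (hj : j ∈ Icc 1 K) :
    MeasurableSet[obs S (M j)] {ω | b j < (stat j ω : EReal)} :=
  (measurable_coe_real_ereal.comp (h.measurable j hj)) measurableSet_Ioi

lemma measurableSet_passedAll_obs (h : Adapted K M stat) {i j : ℕ} (hij : i ≤ j)
    (hj : j ∈ Icc 1 K) : MeasurableSet[obs S (M j)] (passedAll stat b i) := by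
  have hinter : passedAll stat b i = ⋂ k ∈ Finset.Icc 1 i, {ω | b k < (stat k ω : EReal)} := by
    ext ω
    simp [passedAll]
  rw [hinter]
  refine Finset.measurableSet_biInter _ fun k hk => ?_
  rw [Finset.mem_Icc] at hk
  have hkK : k ∈ Icc 1 K := ⟨hk.1, hk.2.trans (hij.trans hj.2)⟩
  exact obs_mono (h.monotoneOn hkK hj (hk.2.trans hij)) _ (h.measurableSet_lt hkK)

lemma measurableSet_passedAll (h : Adapted K M stat) {j : ℕ} (hj : j ≤ K) :
    MeasurableSet (passedAll stat b j) :=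
  obs_le _ _ (h.measurableSet_passedAll_obs hj ⟨h.one_le, le_rfl⟩)

lemma measurableSet_lastStage_eq (h : Adapted K M stat) {j : ℕ} (hj : j ∈ Icc 1 K) :
    MeasurableSet[obs S (M j)] {ω | lastStage K stat b ω = j} := by
  simp only [lastStage_eq_iff hj]
  refine (h.measurableSet_passedAll_obs (Nat.sub_le j 1) hj).inter ?_
  by_cases hjK : j = K
  · simp only [hjK, true_or]
    exact MeasurableSet.univ
  · simp only [hjK, false_or, ← not_lt]
    exact (h.measurableSet_lt hj).compl

lemma measurableSet_size_eq (h : Adapted K M stat) (n : ℕ) :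
    MeasurableSet[obs S n] {ω | (stagedTest K M stat b).1 ω = n} := by
  have hunion : {ω | (stagedTest K M stat b).1 ω = n} =
      ⋃ j ∈ (Finset.Icc 1 K).filter (M · = n), {ω | lastStage K stat b ω = j} := by
    ext ω
    simp only [stagedTest, mem_ofPred_eq, Nat.cast_inj, mem_iUnion, Finset.mem_filter,
      Finset.mem_Icc, exists_prop]
    exact ⟨fun hω => ⟨_, ⟨lastStage_mem_Icc h.one_le ω, hω⟩, rfl⟩,
      fun ⟨_, ⟨_, hjn⟩, hj⟩ => hj ▸ hjn⟩
  rw [hunion]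
  refine Finset.measurableSet_biUnion _ fun j hj => ?_
  rw [Finset.mem_filter, Finset.mem_Icc] at hj
  exact hj.2 ▸ h.measurableSet_lastStage_eq hj.1

lemma measurableSet_size_eq_reject (h : Adapted K M stat) (n : ℕ) : MeasurableSet[obs S n]
    {ω | (stagedTest K M stat b).1 ω = n ∧ (stagedTest K M stat b).2 ω = 1} := by
  have hsize {ω : ℕ → S} (hω : ω ∈ passedAll stat b K) : (stagedTest K M stat b).1 ω = M K := by
    simp only [stagedTest, lastStage_eq_of_mem_passedAll h.one_le hω]
  simp only [stagedTest_snd_eq_one_iff]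
  by_cases hn : M K = n
  · rw [← hn]
    convert h.measurableSet_passedAll_obs (b := b) le_rfl (right_mem_Icc.2 h.one_le) using 1
    ext ω
    exact and_iff_right_of_imp hsize
  · convert MeasurableSet.empty
    refine eq_empty_of_forall_notMem fun ω ⟨hω, hpass⟩ => hn ?_
    rw [hsize hpass] at hω
    exact_mod_cast hω

lemma isTest (h : Adapted K M stat) :
    H.IsTest (stagedTest K M stat b).1 (stagedTest K M stat b).2 where
  one_le ω := by
    have hmem := lastStage_mem_Icc (stat := stat) (b := b) h.one_le ω
    have hone := h.one_le_size.trans (h.monotoneOn (left_mem_Icc.2 h.one_le) hmem hmem.1)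
    change ((1 : ℕ) : ℕ∞) ≤ (M _ : ℕ∞)
    exact_mod_cast hone
  finite _ := .of_forall fun _ => ENat.natCast_ne_top _
  stopping n _ := h.measurableSet_size_eq n
  measurable_decision :=
    Measurable.ite (h.measurableSet_passedAll le_rfl) measurable_const measurable_const
  decision n _ i := by
    fin_cases i
    · convert (h.measurableSet_size_eq (b := b) n).diff
        (h.measurableSet_size_eq_reject (b := b) n) using 1
      ext ω
      simp only [Fin.zero_eta, mem_ofPred_eq, Set.mem_sdiff, stagedTest_snd_eq_zero_iff,
        stagedTest_snd_eq_one_iff]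
      tauto
    · exact h.measurableSet_size_eq_reject n

lemma mem_testClass (h : Adapted K M stat) {α β : ℝ}
    (hα : (H.P 0).real (passedAll stat b K) ≤ α)
    (hβ : ∑ j ∈ Finset.Icc 1 K, (H.P 1).real {ω | (stat j ω : EReal) ≤ b j} ≤ β) :
    stagedTest K M stat b ∈ H.testClass α β := by
  refine ⟨h.isTest, by simpa only [stagedTest_snd_eq_one_iff, ofPred_mem_eq] using hα,
    le_trans ?_ hβ⟩
  refine (measureReal_mono ?_ (measure_ne_top _ _)).trans (measureReal_biUnion_finset_le _ _)
  intro ω hω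
  rw [mem_ofPred_eq, stagedTest_snd_eq_zero_iff] at hω
  simpa [passedAll, and_assoc] using hω

lemma ess_le (h : Adapted K M stat) (i : Fin 2) :
    H.ess i (stagedTest K M stat b).1 ≤ M K :=
  calc _ ≤ ∫⁻ _, (M K : ℝ≥0∞) ∂(H.P i) := by
        refine lintegral_mono fun ω => ?_
        have hmem := lastStage_mem_Icc (stat := stat) (b := b) h.one_le ω
        simpa only [stagedTest, ENat.toENNReal_coe, Nat.cast_le] using
          h.monotoneOn hmem (right_mem_Icc.2 h.one_le) hmem.2
    _ = M K := by simp

lemma le_ess (h : Adapted K M stat) (i : Fin 2) :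
    M K * H.P i (passedAll stat b K) ≤ H.ess i (stagedTest K M stat b).1 :=
  calc _ = ∫⁻ _ in passedAll stat b K, (M K : ℝ≥0∞) ∂(H.P i) := (setLIntegral_const _ _).symm
    _ ≤ ∫⁻ ω in passedAll stat b K, ((stagedTest K M stat b).1 ω : ℝ≥0∞) ∂(H.P i) := by
        refine setLIntegral_mono' (h.measurableSet_passedAll le_rfl) fun ω hω => ?_
        simp only [stagedTest, lastStage_eq_of_mem_passedAll h.one_le hω, ENat.toENNReal_coe,
          le_refl]
    _ ≤ _ := setLIntegral_le_lintegral _ _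

lemma mul_one_sub_le_ess_one (h : Adapted K M stat) {α β : ℝ}
    (hmem : stagedTest K M stat b ∈ H.testClass α β) :
    ENNReal.ofReal (M K * (1 - β)) ≤ H.ess 1 (stagedTest K M stat b).1 := by
  refine le_trans ?_ (h.le_ess 1)
  have haccept : (H.P 1).real (passedAll stat b K)ᶜ ≤ β := by
    have herr := hmem.2.2
    simp only [stagedTest_snd_eq_zero_iff] at herr
    exact herr
  rw [probReal_compl_eq_one_sub (h.measurableSet_passedAll le_rfl)] at haccept
  rw [← ofReal_measureReal, ← ENNReal.ofReal_natCast, ← ENNReal.ofReal_mul (Nat.cast_nonneg _)]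
  gcongr
  linarith

lemma ess_le_sum (h : Adapted K M stat) (i : Fin 2) :
    H.ess i (stagedTest K M stat b).1 ≤
      M 1 + ∑ j ∈ Finset.Ico 1 K, M (j + 1) * H.P i (passedAll stat b j) := by
  have hmeas : ∀ j ∈ Finset.Ico 1 K, MeasurableSet (passedAll stat b j) := fun j hj =>
    h.measurableSet_passedAll (Finset.mem_Ico.1 hj).2.le
  calc _ ≤ ∫⁻ ω, (M 1 + ∑ j ∈ Finset.Ico 1 K,
          (passedAll stat b j).indicator (fun _ => (M (j + 1) : ℝ≥0∞)) ω) ∂(H.P i) := by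
        refine lintegral_mono fun ω => ?_
        obtain ⟨hone, hle⟩ := lastStage_mem_Icc (stat := stat) (b := b) h.one_le ω
        simp only [stagedTest, ENat.toENNReal_coe]
        obtain ⟨j, hj⟩ := Nat.exists_eq_add_of_le' hone
        rcases Nat.eq_zero_or_pos j with rfl | hpos
        · rw [hj]
          exact le_self_add
        · refine le_add_of_nonneg_of_le zero_le (le_trans ?_ (Finset.single_le_sum
            (fun _ _ => zero_le) (Finset.mem_Ico.2 ⟨hpos, by omega⟩)))
          rw [indicator_of_mem (mem_passedAll_of_lt_lastStage (K := K) (by omega)), hj]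
    _ = _ := by
        rw [lintegral_add_left measurable_const, lintegral_finsetSum _ fun j hj =>
          measurable_const.indicator (hmeas j hj), lintegral_const, measure_univ, mul_one]
        exact congrArg _ (Finset.sum_congr rfl fun j hj => lintegral_indicator_const (hmeas j hj) _)

end Adapted

lemma sum_sq_mul_pow_le {a : ℝ} (ha : 0 ≤ a) (ha8 : a ≤ 1 / 8) (K : ℕ) :
    ∑ j ∈ Finset.Ico 1 K, ((j + 1 : ℕ) : ℝ) ^ 2 * a ^ j ≤ 8 * a := by
  have hterm (j : ℕ) : ((j + 1 : ℕ) : ℝ) ^ 2 * a ^ j ≤ (4 * a) ^ j := by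
    have hpow : ((j + 1 : ℕ) : ℝ) ≤ 2 ^ j := by exact_mod_cast Nat.lt_two_pow_self (n := j)
    calc ((j + 1 : ℕ) : ℝ) ^ 2 * a ^ j ≤ (2 ^ j) ^ 2 * a ^ j := by gcongr
      _ = (4 * a) ^ j := by rw [mul_pow, ← pow_mul, mul_comm j, pow_mul]; norm_num
  calc _ ≤ ∑ j ∈ Finset.Ico 1 K, (4 * a) ^ j := Finset.sum_le_sum fun j _ => hterm j
    _ ≤ (4 * a) ^ 1 / (1 - 4 * a) := geom_sum_Ico_le_of_lt_one (by positivity) (by linarith)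
    _ ≤ 8 * a := by
      rw [pow_one, div_le_iff₀ (by linarith)]
      nlinarith

lemma Adapted.ess_zero_le (h : Adapted K M stat) {B a : ℝ} (hB : 0 ≤ B) (ha : 0 ≤ a)
    (ha8 : a ≤ 1 / 8) (hM : ∀ j ∈ Icc 1 K, (M j : ℝ) ≤ j ^ 2 * B)
    (hP : ∀ j ∈ Icc 1 K, (H.P 0).real (passedAll stat b j) ≤ a ^ j) :
    H.ess 0 (stagedTest K M stat b).1 ≤ ENNReal.ofReal (B * (1 + 8 * a)) := by
  have hterm : ∀ j ∈ Finset.Ico 1 K, (M (j + 1) : ℝ≥0∞) * H.P 0 (passedAll stat b j) ≤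
      ENNReal.ofReal (B * (((j + 1 : ℕ) : ℝ) ^ 2 * a ^ j)) := by
    intro j hj
    rw [Finset.mem_Ico] at hj
    rw [← mul_assoc, mul_comm B, ENNReal.ofReal_mul (by positivity), ← ENNReal.ofReal_natCast,
      ← ofReal_measureReal]
    gcongr
    · exact hM _ ⟨by omega, hj.2⟩
    · exact hP j ⟨hj.1, hj.2.le⟩
  have hfirst : (M 1 : ℝ≥0∞) ≤ ENNReal.ofReal B := by
    rw [← ENNReal.ofReal_natCast]
    exact ENNReal.ofReal_le_ofReal (by simpa using hM 1 ⟨le_rfl, h.one_le⟩)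
  calc _ ≤ _ := h.ess_le_sum 0
    _ ≤ ENNReal.ofReal B +
        ∑ j ∈ Finset.Ico 1 K, ENNReal.ofReal (B * (((j + 1 : ℕ) : ℝ) ^ 2 * a ^ j)) :=
        add_le_add hfirst (Finset.sum_le_sum hterm)
    _ = ENNReal.ofReal (B + B * ∑ j ∈ Finset.Ico 1 K, ((j + 1 : ℕ) : ℝ) ^ 2 * a ^ j) := by
        rw [← ENNReal.ofReal_sum_of_nonneg fun j _ => by positivity, ← Finset.mul_sum,
          ← ENNReal.ofReal_add hB (mul_nonneg hB (Finset.sum_nonneg fun j _ => by positivity))]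
    _ ≤ ENNReal.ofReal (B * (1 + 8 * a)) := by
        rw [mul_one_add]
        gcongr
        exact sum_sq_mul_pow_le ha ha8 K

end AdaptedStages
end SimpleTesting

namespace SimpleTesting

/-! ### Error control of the two tests -/

section Levels

variable {α β : ℝ} {K : ℕ}

lemma half_pow_le_typeIILevel (hβ : β ∈ Ioo (0 : ℝ) 1) (K j : ℕ) :
    (β / 2) ^ j ≤ typeIILevel β K j := by
  obtain ⟨hβ0, hβ1⟩ := hβ
  unfold typeIILevel
  split_ifs with h
  · have hsum : ∑ i ∈ Finset.Icc 2 K, (β / 2) ^ i ≤ (β / 2) ^ 2 / (1 - β / 2) :=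
      geom_sum_Ico_le_of_lt_one (m := 2) (n := K + 1) (by positivity) (by linarith)
    have hgeom : (β / 2) ^ 2 / (1 - β / 2) ≤ β / 2 := by
      rw [div_le_iff₀ (by linarith)]
      nlinarith
    rw [h, pow_one]
    linarith
  · exact le_rfl

lemma typeIILevel_pos (hβ : β ∈ Ioo (0 : ℝ) 1) (K j : ℕ) : 0 < typeIILevel β K j :=
  (pow_pos (half_pos hβ.1) j).trans_le (half_pow_le_typeIILevel hβ K j)

lemma typeIILevel_le_pow (hβ : 0 ≤ β) (K j : ℕ) : typeIILevel β K j ≤ β ^ j := by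
  unfold typeIILevel
  split_ifs with h
  · rw [h, pow_one]
    exact sub_le_self _ (Finset.sum_nonneg fun i _ => by positivity)
  · gcongr
    linarith

lemma sum_typeIILevel (β : ℝ) (hK : 1 ≤ K) : ∑ j ∈ Finset.Icc 1 K, typeIILevel β K j = β := by
  have hlater : ∑ j ∈ Finset.Ioc 1 K, typeIILevel β K j = ∑ i ∈ Finset.Icc 2 K, (β / 2) ^ i := by
    refine Finset.sum_congr rfl fun j hj => ?_
    rw [typeIILevel, if_neg (by rw [Finset.mem_Icc] at hj; omega)]
  rw [← Finset.add_sum_Ioc_eq_sum_Icc hK, hlater, typeIILevel, if_pos rfl, sub_add_cancel]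

lemma rootLevel_mem_Ioo (hα : α ∈ Ioo (0 : ℝ) 1) (hK : 1 ≤ K) :
    α ^ (1 / (K : ℝ)) ∈ Ioo (0 : ℝ) 1 :=
  ⟨Real.rpow_pos_of_pos hα.1 _, Real.rpow_lt_one hα.1.le hα.2 (by positivity)⟩

lemma rootLevel_pow (hα : 0 ≤ α) (K j : ℕ) :
    (α ^ (1 / (K : ℝ))) ^ j = α ^ ((j : ℝ) / K) := by
  rw [← Real.rpow_natCast, ← Real.rpow_mul hα, one_div_mul_eq_div]

lemma rootLevel_pow_self (hα : 0 ≤ α) (hK : 1 ≤ K) : (α ^ (1 / (K : ℝ))) ^ K = α := by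
  rw [rootLevel_pow hα, div_self (by positivity), Real.rpow_one]

end Levels

lemma passedAll_succ {S : Type*} {stat : ℕ → (ℕ → S) → ℝ} {b : ℕ → EReal} (j : ℕ) :
    passedAll stat b (j + 1) =
      passedAll stat b j ∩ {ω | b (j + 1) < (stat (j + 1) ω : EReal)} := by
  ext ω
  simp only [passedAll, Finset.mem_Icc, mem_ofPred_eq, mem_inter_iff]
  refine ⟨fun h => ⟨fun i hi => h i (by omega), h _ (by omega)⟩, fun h i hi => ?_⟩
  rcases hi.2.eq_or_lt with rfl | hlt
  · exact h.2
  · exact h.1 i (by omega)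

variable {S : Type*} [MeasurableSpace S] {H : SimpleTesting S}

section SequentialThresholding

variable {α β : ℝ} {K : ℕ}

lemma monotone_stTotal : Monotone (H.stTotal α β K) := fun _ _ h =>
  Finset.sum_le_sum_of_subset (Finset.Icc_subset_Icc_right h)

lemma stTotal_succ (j : ℕ) :
    H.stTotal α β K (j + 1) = H.stTotal α β K j + H.stSize α β K (j + 1) :=
  Finset.sum_Icc_succ_top (by omega) _

lemma stStat_succ (j : ℕ) (ω : ℕ → S) : H.stStat α β K (j + 1) ω =
    H.avgLlr (H.stSize α β K (j + 1)) fun k => ω (H.stTotal α β K j + k) := by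
  rw [stStat, stTotal_succ, llr_add, avgLlr, Nat.add_sub_cancel, add_sub_cancel_left]

namespace Regular

lemma one_le_stSize (hH : H.Regular) (hα : α ∈ Ioo (0 : ℝ) 1) (hβ : β ∈ Ioo (0 : ℝ) 1)
    (hK : 1 ≤ K) (j : ℕ) : 1 ≤ H.stSize α β K j :=
  (hH.nStar_spec (rootLevel_mem_Ioo hα hK).1 (typeIILevel_pos hβ K j)).1

lemma stThreshold_spec (hH : H.Regular) (hα : α ∈ Ioo (0 : ℝ) 1) (hβ : β ∈ Ioo (0 : ℝ) 1)
    (hK : 1 ≤ K) (j : ℕ) : H.ErrorsLE (H.stSize α β K j) (H.stThreshold α β K j)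
      (α ^ (1 / (K : ℝ))) (typeIILevel β K j) :=
  hH.cStar_spec (rootLevel_mem_Ioo hα hK) (typeIILevel_pos hβ K j)

lemma adapted_ST (hH : H.Regular) (hα : α ∈ Ioo (0 : ℝ) 1) (hβ : β ∈ Ioo (0 : ℝ) 1)
    (hK : 1 ≤ K) : Adapted K (H.stTotal α β K) (H.stStat α β K) where
  one_le := hK
  one_le_size := by simpa [stTotal] using hH.one_le_stSize hα hβ hK 1
  monotoneOn := monotone_stTotal.monotoneOn _
  measurable j _ := ((H.measurable_llr_obs (H.stTotal α β K j)).sub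
    ((H.measurable_llr_obs (H.stTotal α β K (j - 1))).mono
      (obs_mono (monotone_stTotal (Nat.sub_le j 1))) le_rfl)).div_const _

lemma P_zero_passedAll_ST_le (hH : H.Regular) (hα : α ∈ Ioo (0 : ℝ) 1)
    (hβ : β ∈ Ioo (0 : ℝ) 1) (hK : 1 ≤ K) {j : ℕ} (hj : j ≤ K) :
    (H.P 0).real (passedAll (H.stStat α β K) (fun j => (H.stThreshold α β K j : EReal)) j) ≤
      (α ^ (1 / (K : ℝ))) ^ j := by
  induction j with
  | zero => simp
  | succ j ih =>
    have hset : {ω | (H.stThreshold α β K (j + 1) : EReal) < (H.stStat α β K (j + 1) ω : EReal)} =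
        (fun ω k => ω (H.stTotal α β K j + k)) ⁻¹'
          {ω | H.stThreshold α β K (j + 1) < H.avgLlr (H.stSize α β K (j + 1)) ω} := by
      ext ω
      simp only [mem_ofPred_eq, mem_preimage, EReal.coe_lt_coe_iff, stStat_succ]
    have hpassed : MeasurableSet[obs S (H.stTotal α β K j)]
        (passedAll (H.stStat α β K) (fun j => (H.stThreshold α β K j : EReal)) j) := by
      rcases Nat.eq_zero_or_pos j with rfl | hpos
      · simp [passedAll]
      · exact (hH.adapted_ST hα hβ hK).measurableSet_passedAll_obs le_rfl ⟨hpos, by omega⟩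
    rw [passedAll_succ, hset, Measure.real, P, infinitePi_inter_preimage_shift _ hpassed
      (measurableSet_lt measurable_const (H.measurable_avgLlr _)), ENNReal.toReal_mul, pow_succ]
    exact mul_le_mul (ih (by omega)) (hH.stThreshold_spec hα hβ hK (j + 1)).1 measureReal_nonneg
      (pow_pos (rootLevel_mem_Ioo hα hK).1 _).le

lemma P_one_stStat_le (hH : H.Regular) (hα : α ∈ Ioo (0 : ℝ) 1) (hβ : β ∈ Ioo (0 : ℝ) 1)
    (hK : 1 ≤ K) (j : ℕ) :
    (H.P 1).real {ω | (H.stStat α β K (j + 1) ω : EReal) ≤ H.stThreshold α β K (j + 1)} ≤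
      typeIILevel β K (j + 1) := by
  have hset : {ω | (H.stStat α β K (j + 1) ω : EReal) ≤ H.stThreshold α β K (j + 1)} =
      univ ∩ (fun ω k => ω (H.stTotal α β K j + k)) ⁻¹'
        {ω | H.avgLlr (H.stSize α β K (j + 1)) ω ≤ H.stThreshold α β K (j + 1)} := by
    ext ω
    simp only [mem_ofPred_eq, mem_preimage, EReal.coe_le_coe_iff, stStat_succ, univ_inter]
  rw [hset, Measure.real, P, infinitePi_inter_preimage_shift _ MeasurableSet.univ
    (measurableSet_le (H.measurable_avgLlr _) measurable_const), measure_univ, one_mul]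
  exact (hH.stThreshold_spec hα hβ hK (j + 1)).2

lemma ST_mem_testClass (hH : H.Regular) (hα : α ∈ Ioo (0 : ℝ) 1) (hβ : β ∈ Ioo (0 : ℝ) 1)
    (hK : 1 ≤ K) : H.ST α β K ∈ H.testClass α β := by
  refine (hH.adapted_ST hα hβ hK).mem_testClass ?_ ?_
  · exact (hH.P_zero_passedAll_ST_le hα hβ hK le_rfl).trans (rootLevel_pow_self hα.1.le hK).le
  · refine le_trans (Finset.sum_le_sum fun j hj => ?_) (sum_typeIILevel β hK).le
    obtain ⟨j, rfl⟩ := Nat.exists_eq_add_of_le' (Finset.mem_Icc.1 hj).1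
    exact hH.P_one_stStat_le hα hβ hK j

lemma le_stTotal (hH : H.Regular) {ε : ℝ} (hε : ε ≤ 1) (hα : α ∈ Ioo (0 : ℝ) 1)
    (hβ : β ∈ Ioo (0 : ℝ) 1) (hK : 1 ≤ K) (ha : α ^ (1 / (K : ℝ)) < 1 - ε)
    (hconv : ∀ δ ∈ Ioc 0 β, H.ConverseAt ε δ) (j : ℕ) :
    (1 - ε) * (j * (j + 1) / 2 * (-Real.log β / H.I 0)) ≤ H.stTotal α β K j := by
  have hI := hH.I_pos
  induction j with
  | zero => simp
  | succ j ih =>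
    have hpos := typeIILevel_pos hβ K (j + 1)
    have hle := typeIILevel_le_pow hβ.1.le K (j + 1)
    have hlt : (1 - ε) * (-Real.log (typeIILevel β K (j + 1)) / H.I 0) <
        H.stSize α β K (j + 1) :=
      (hconv _ ⟨hpos, hle.trans (pow_le_of_le_one hβ.1.le hβ.2.le (by omega))⟩).lt_nStar hH
        (rootLevel_mem_Ioo hα hK).1 ha hpos
    have hlog : (j + 1 : ℕ) * -Real.log β ≤ -Real.log (typeIILevel β K (j + 1)) := by
      have hmono := Real.log_le_log hpos hle
      rw [Real.log_pow] at hmono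
      linarith
    have hsize : (1 - ε) * ((j + 1 : ℕ) * -Real.log β / H.I 0) ≤ H.stSize α β K (j + 1) := by
      refine le_trans ?_ hlt.le
      gcongr
    rw [mul_div_assoc] at hsize
    rw [stTotal_succ]
    push_cast at hsize ⊢
    linarith

lemma le_ess_one_ST (hH : H.Regular) {ε : ℝ} (hε : ε ≤ 1) (hα : α ∈ Ioo (0 : ℝ) 1)
    (hβ : β ∈ Ioo (0 : ℝ) 1) (hK : 1 ≤ K) (ha : α ^ (1 / (K : ℝ)) < 1 - ε)
    (hconv : ∀ δ ∈ Ioc 0 β, H.ConverseAt ε δ) :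
    ENNReal.ofReal ((1 - ε) * (K * (K + 1) / 2 * (-Real.log β / H.I 0)) * (1 - β)) ≤
      H.ess 1 (H.ST α β K).1 := by
  refine le_trans ?_ ((hH.adapted_ST hα hβ hK).mul_one_sub_le_ess_one
    (hH.ST_mem_testClass hα hβ hK))
  have hnonneg := sub_nonneg.2 hβ.2.le
  gcongr
  exact hH.le_stTotal hε hα hβ hK ha hconv K

end Regular
end SequentialThresholding

section ModifiedSequentialThresholding

variable {r : ℕ} {α β : ℝ} {K : ℕ}

lemma ErrorsLE.modThresholds_nonempty {N : ℕ} {c a δ : ℝ} (h : H.ErrorsLE N c a δ)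
    (A : Set (ℕ → S)) : (H.modThresholds A N a δ).Nonempty :=
  ⟨c, (measureReal_mono inter_subset_left).trans h.1, h.2⟩

lemma Regular.modThresholds_modSize_nonempty (hH : H.Regular) (r : ℕ) (s : ModStage S) {a δ : ℝ}
    (ha : 0 < a) (hδ : 0 < δ) :
    (H.modThresholds s.passed (s.total + H.modSize r s a δ) a δ).Nonempty := by
  obtain ⟨c, hc⟩ := hH.exists_eventually_errorsLE ha hδ
  obtain ⟨n, hn, hrn⟩ :=
    (((tendsto_add_atTop_nat s.total).eventually hc).and (eventually_ge_atTop r)).exists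
  rw [add_comm] at hn
  exact (Nat.sInf_mem (s := {n | r ≤ n ∧ (H.modThresholds s.passed (s.total + n) a δ).Nonempty})
    ⟨n, hrn, hn.modThresholds_nonempty _⟩).2

lemma ErrorsLE.modNext_total_le {N : ℕ} {c a δ : ℝ} (h : H.ErrorsLE N c a δ) {s : ModStage S}
    (hN : s.total + r ≤ N) : (H.modNext r s a δ).total ≤ N := by
  have hle : H.modSize r s a δ ≤ N - s.total := by
    refine Nat.sInf_le ⟨by omega, ?_⟩
    rw [Nat.add_sub_cancel' (by omega)]
    exact h.modThresholds_nonempty _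
  simp only [modNext]
  omega

lemma monotone_modStage_total : Monotone fun j => (H.modStage r α β K j).total := by
  refine monotone_nat_of_le_succ fun j => ?_
  cases j with
  | zero => exact Nat.zero_le _
  | succ j => exact Nat.le_add_right _ _

variable (H) in
/-- The statistic of stage `j` of mod-ST. -/
noncomputable def modStat (r : ℕ) (α β : ℝ) (K j : ℕ) : (ℕ → S) → ℝ :=
  H.avgLlr (H.modStage r α β K j).total

variable (H) in
/-- The threshold `b_j` of stage `j` of mod-ST. -/
noncomputable def modThreshold (r : ℕ) (α β : ℝ) (K j : ℕ) : EReal :=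
  (H.modStage r α β K j).threshold

lemma modStage_passed (r : ℕ) (α β : ℝ) (K j : ℕ) :
    (H.modStage r α β K j).passed = passedAll (H.modStat r α β K) (H.modThreshold r α β K) j := by
  induction j with
  | zero => simp [modStage, passedAll]
  | succ j ih =>
    rw [passedAll_succ, ← ih]
    cases j with
    | zero => simp [modStage, modStat, modThreshold]
    | succ j => rfl

namespace Regular

lemma adapted_modST (hH : H.Regular) (r : ℕ) (hα : α ∈ Ioo (0 : ℝ) 1) (hβ : β ∈ Ioo (0 : ℝ) 1)
    (hK : 1 ≤ K) : Adapted K (fun j => (H.modStage r α β K j).total) (H.modStat r α β K) where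
  one_le := hK
  one_le_size := hH.one_le_stSize hα hβ hK 1
  monotoneOn := monotone_modStage_total.monotoneOn _
  measurable _ _ := H.measurable_avgLlr_obs _

lemma modStage_errors (hH : H.Regular) (r : ℕ) (hα : α ∈ Ioo (0 : ℝ) 1)
    (hβ : β ∈ Ioo (0 : ℝ) 1) (hK : 1 ≤ K) (j : ℕ) :
    (H.P 0).real (passedAll (H.modStat r α β K) (H.modThreshold r α β K) (j + 1)) ≤
        (α ^ (1 / (K : ℝ))) ^ (j + 1) ∧
      (H.P 1).real {ω | (H.modStat r α β K (j + 1) ω : EReal) ≤ H.modThreshold r α β K (j + 1)} ≤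
        typeIILevel β K (j + 1) := by
  rw [← modStage_passed]
  cases j with
  | zero =>
    simpa [modStage, modStat, modThreshold, ErrorsLE] using hH.stThreshold_spec hα hβ hK 1
  | succ j =>
    have hspec := sInf_modThresholds_spec (hH.modThresholds_modSize_nonempty r
      (H.modStage r α β K (j + 1)) (Real.rpow_pos_of_pos hα.1 (((j + 2 : ℕ) : ℝ) / K))
      (typeIILevel_pos hβ K (j + 2)))
    rw [inter_comm] at hspec
    rw [rootLevel_pow hα.1.le]
    exact hspec

lemma modST_mem_testClass (hH : H.Regular) (r : ℕ) (hα : α ∈ Ioo (0 : ℝ) 1)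
    (hβ : β ∈ Ioo (0 : ℝ) 1) (hK : 1 ≤ K) : H.modST r α β K ∈ H.testClass α β := by
  refine (hH.adapted_modST r hα hβ hK).mem_testClass (b := H.modThreshold r α β K) ?_ ?_
  · obtain ⟨k, rfl⟩ := Nat.exists_eq_add_of_le' hK
    exact (hH.modStage_errors r hα hβ hK k).1.trans (rootLevel_pow_self hα.1.le hK).le
  · refine le_trans (Finset.sum_le_sum fun j hj => ?_) (sum_typeIILevel β hK).le
    obtain ⟨j, rfl⟩ := Nat.exists_eq_add_of_le' (Finset.mem_Icc.1 hj).1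
    exact (hH.modStage_errors r hα hβ hK j).2

end Regular
end ModifiedSequentialThresholding

/-! ### Bounds for the stage sizes -/

section Sizes

variable {r : ℕ} {α β : ℝ} {K : ℕ} {B c : ℝ}

variable (H) in
/-- Every sample size `N ≥ j B` admits the threshold `c` at the error levels of stage `j`. -/
def SizeSuffices (α β : ℝ) (K : ℕ) (B c : ℝ) : Prop :=
  ∀ j N : ℕ, 1 ≤ j → j * B ≤ N → H.ErrorsLE N c ((α ^ (1 / (K : ℝ))) ^ j) ((β / 2) ^ j)

namespace SizeSuffices

lemma errorsLE_ceil (h : H.SizeSuffices α β K B c) (hβ : β ∈ Ioo (0 : ℝ) 1) (j : ℕ) :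
    H.ErrorsLE ⌈(j + 1 : ℕ) * B⌉₊ c ((α ^ (1 / (K : ℝ))) ^ (j + 1)) (typeIILevel β K (j + 1)) :=
  (h (j + 1) _ (by omega) (Nat.le_ceil _)).imp_right
    fun hle => hle.trans (half_pow_le_typeIILevel hβ K (j + 1))

lemma stSize_le (h : H.SizeSuffices α β K B c) (hα : α ∈ Ioo (0 : ℝ) 1)
    (hβ : β ∈ Ioo (0 : ℝ) 1) (hK : 1 ≤ K) (hB : 0 < B) (j : ℕ) :
    H.stSize α β K (j + 1) ≤ ⌈(j + 1 : ℕ) * B⌉₊ := by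
  have ha := rootLevel_mem_Ioo hα hK
  have herr := h.errorsLE_ceil hβ j
  exact ErrorsLE.nStar_le ⟨herr.1.trans (pow_le_of_le_one ha.1.le ha.2.le (by omega)), herr.2⟩
    (Nat.one_le_ceil_iff.2 (by positivity))

lemma stTotal_le (h : H.SizeSuffices α β K B c) (hα : α ∈ Ioo (0 : ℝ) 1)
    (hβ : β ∈ Ioo (0 : ℝ) 1) (hK : 1 ≤ K) (hB : 0 < B) (j : ℕ) :
    (H.stTotal α β K j : ℝ) ≤ j * (j + 1) / 2 * (B + 1) := by
  induction j with
  | zero => simp [stTotal]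
  | succ j ih =>
    have hsize : (H.stSize α β K (j + 1) : ℝ) ≤ (j + 1 : ℕ) * B + 1 :=
      (Nat.cast_le.2 (h.stSize_le hα hβ hK hB j)).trans (Nat.ceil_lt_add_one (by positivity)).le
    rw [stTotal_succ]
    push_cast at hsize ⊢
    nlinarith [(Nat.cast_nonneg j : (0 : ℝ) ≤ j)]

lemma modStage_total_le_ceil (h : H.SizeSuffices α β K B c) (hα : α ∈ Ioo (0 : ℝ) 1)
    (hβ : β ∈ Ioo (0 : ℝ) 1) (hK : 1 ≤ K) (hB : 0 < B) (hr : r ≤ B) (j : ℕ) :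
    (H.modStage r α β K (j + 1)).total ≤ ⌈(j + 1 : ℕ) * B⌉₊ := by
  induction j with
  | zero => exact h.stSize_le hα hβ hK hB 0
  | succ j ih =>
    have herr := h.errorsLE_ceil hβ (j + 1)
    rw [rootLevel_pow hα.1.le] at herr
    refine herr.modNext_total_le (r := r) (s := H.modStage r α β K (j + 1)) ?_
    calc _ ≤ ⌈(j + 1 : ℕ) * B⌉₊ + r := Nat.add_le_add_right ih r
      _ = ⌈(j + 1 : ℕ) * B + r⌉₊ := (Nat.ceil_add_natCast (by positivity) r).symm
      _ ≤ _ := by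
        refine Nat.ceil_mono ?_
        push_cast
        linarith

lemma modStage_total_le (h : H.SizeSuffices α β K B c) (hα : α ∈ Ioo (0 : ℝ) 1)
    (hβ : β ∈ Ioo (0 : ℝ) 1) (hK : 1 ≤ K) (hB : 0 < B) (hr : r ≤ B) {j : ℕ} (hj : 1 ≤ j) :
    ((H.modStage r α β K j).total : ℝ) ≤ j * (B + 1) := by
  obtain ⟨j, rfl⟩ := Nat.exists_eq_add_of_le' hj
  have hceil := (Nat.cast_le (α := ℝ).2 (h.modStage_total_le_ceil hα hβ hK hB hr j)).trans
    (Nat.ceil_lt_add_one (by positivity)).le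
  push_cast at hceil ⊢
  nlinarith [(Nat.cast_nonneg j : (0 : ℝ) ≤ j)]

lemma ess_zero_ST_le (h : H.SizeSuffices α β K B c) (hH : H.Regular) (hα : α ∈ Ioo (0 : ℝ) 1)
    (hβ : β ∈ Ioo (0 : ℝ) 1) (hK : 1 ≤ K) (hB : 0 < B) (ha : α ^ (1 / (K : ℝ)) ≤ 1 / 8) :
    H.ess 0 (H.ST α β K).1 ≤ ENNReal.ofReal ((B + 1) * (1 + 8 * α ^ (1 / (K : ℝ)))) := by
  refine (hH.adapted_ST hα hβ hK).ess_zero_le (by linarith) (rootLevel_mem_Ioo hα hK).1.le ha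
    (fun j hj => (h.stTotal_le hα hβ hK hB j).trans ?_)
    fun j hj => hH.P_zero_passedAll_ST_le hα hβ hK hj.2
  have hj1 : (1 : ℝ) ≤ j := by exact_mod_cast hj.1
  gcongr
  nlinarith

lemma ess_zero_modST_le (h : H.SizeSuffices α β K B c) (hH : H.Regular)
    (hα : α ∈ Ioo (0 : ℝ) 1) (hβ : β ∈ Ioo (0 : ℝ) 1) (hK : 1 ≤ K) (hB : 0 < B) (hr : r ≤ B)
    (ha : α ^ (1 / (K : ℝ)) ≤ 1 / 8) :
    H.ess 0 (H.modST r α β K).1 ≤ ENNReal.ofReal ((B + 1) * (1 + 8 * α ^ (1 / (K : ℝ)))) := by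
  refine (hH.adapted_modST r hα hβ hK).ess_zero_le (b := H.modThreshold r α β K) (by linarith)
    (rootLevel_mem_Ioo hα hK).1.le ha
    (fun j hj => (h.modStage_total_le hα hβ hK hB hr hj.1).trans ?_) fun j hj => ?_
  · have hj1 : (1 : ℝ) ≤ j := by exact_mod_cast hj.1
    gcongr
    nlinarith
  · obtain ⟨j, rfl⟩ := Nat.exists_eq_add_of_le' hj.1
    exact (hH.modStage_errors r hα hβ hK j).1

lemma ess_one_ST_le (h : H.SizeSuffices α β K B c) (hH : H.Regular) (hα : α ∈ Ioo (0 : ℝ) 1)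
    (hβ : β ∈ Ioo (0 : ℝ) 1) (hK : 1 ≤ K) (hB : 0 < B) :
    H.ess 1 (H.ST α β K).1 ≤ ENNReal.ofReal (K * (K + 1) / 2 * (B + 1)) := by
  refine ((hH.adapted_ST hα hβ hK).ess_le 1).trans ?_
  rw [← ENNReal.ofReal_natCast]
  exact ENNReal.ofReal_le_ofReal (h.stTotal_le hα hβ hK hB K)

lemma ess_one_modST_le (h : H.SizeSuffices α β K B c) (hH : H.Regular) (hα : α ∈ Ioo (0 : ℝ) 1)
    (hβ : β ∈ Ioo (0 : ℝ) 1) (hK : 1 ≤ K) (hB : 0 < B) (hr : r ≤ B) :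
    H.ess 1 (H.modST r α β K).1 ≤ ENNReal.ofReal (K * (B + 1)) := by
  refine ((hH.adapted_modST r hα hβ hK).ess_le (b := H.modThreshold r α β K) 1).trans ?_
  rw [← ENNReal.ofReal_natCast]
  exact ENNReal.ofReal_le_ofReal (h.modStage_total_le hα hβ hK hB hr hK)

end SizeSuffices
end Sizes
end SimpleTesting

namespace SimpleTesting

/-! ### Two-stage tests that can reject at either stage -/

section TwoStage

variable {S : Type*} {n₁ n₂ : ℕ} {A B : Set (ℕ → S)}

open Classical in
/-- The test that rejects the null after `n₁` observations on `A`, and otherwise takes `n₂`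
observations in total and rejects the null on `B`. Unlike the tests in stages above, it can reject
early, so it is cheap under the alternative. -/
noncomputable def twoStageTest (n₁ n₂ : ℕ) (A B : Set (ℕ → S)) :
    ((ℕ → S) → ℕ∞) × ((ℕ → S) → Fin 2) :=
  (fun ω => if ω ∈ A then (n₁ : ℕ∞) else n₂, fun ω => if ω ∈ A ∪ B then 1 else 0)

lemma setOf_twoStageTest_snd_eq_one : {ω | (twoStageTest n₁ n₂ A B).2 ω = 1} = A ∪ B := by
  ext ω
  by_cases hA : ω ∈ A <;> by_cases hB : ω ∈ B <;> simp [twoStageTest, hA, hB]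

lemma setOf_twoStageTest_snd_eq_zero :
    {ω | (twoStageTest n₁ n₂ A B).2 ω = 0} = Aᶜ ∩ Bᶜ := by
  ext ω
  by_cases hA : ω ∈ A <;> by_cases hB : ω ∈ B <;> simp [twoStageTest, hA, hB]

lemma setOf_twoStageTest_fst_eq (n : ℕ) : {ω | (twoStageTest n₁ n₂ A B).1 ω = n} =
    (A ∩ {_ω | n₁ = n}) ∪ (Aᶜ ∩ {_ω | n₂ = n}) := by
  ext ω
  by_cases hA : ω ∈ A <;> simp [twoStageTest, hA]

variable [MeasurableSpace S]

lemma measurableSet_obs_inter_eq {m : ℕ} {E : Set (ℕ → S)} (hE : MeasurableSet[obs S m] E)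
    (n : ℕ) : MeasurableSet[obs S n] (E ∩ {_ω | m = n}) := by
  by_cases hmn : m = n
  · subst hmn
    simpa using hE
  · simp [hmn]

variable {H : SimpleTesting S}

lemma isTest_twoStageTest (h₁ : 1 ≤ n₁) (h₁₂ : n₁ ≤ n₂) (hA : MeasurableSet[obs S n₁] A)
    (hB : MeasurableSet[obs S n₂] B) :
    H.IsTest (twoStageTest n₁ n₂ A B).1 (twoStageTest n₁ n₂ A B).2 := by
  have hA₂ := obs_mono h₁₂ A hA
  have hsize (n : ℕ) {E : Set (ℕ → S)} (hAE : MeasurableSet[obs S n₁] (A ∩ E))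
      (hAcE : MeasurableSet[obs S n₂] (Aᶜ ∩ E)) :
      MeasurableSet[obs S n] ({ω | (twoStageTest n₁ n₂ A B).1 ω = n} ∩ E) := by
    rw [setOf_twoStageTest_fst_eq, union_inter_distrib_right, inter_right_comm,
      inter_right_comm Aᶜ]
    exact (measurableSet_obs_inter_eq hAE n).union (measurableSet_obs_inter_eq hAcE n)
  refine ⟨fun ω => ?_, fun i => .of_forall fun ω => ?_, fun n _ => ?_, ?_, fun n _ i => ?_⟩
  · simp only [twoStageTest]
    split_ifs
    · exact_mod_cast h₁
    · exact_mod_cast h₁.trans h₁₂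
  · simp only [twoStageTest]
    split_ifs <;> exact ENat.natCast_ne_top _
  · simpa using hsize n (E := univ) (by simpa using hA) (by simpa using hA₂.compl)
  · exact Measurable.ite (obs_le _ _ (hA₂.union hB)) measurable_const measurable_const
  · refine hsize n (E := {ω | (twoStageTest n₁ n₂ A B).2 ω = i}) ?_ ?_ <;> fin_cases i
    · simp [setOf_twoStageTest_snd_eq_zero, ← inter_assoc]
    · simpa [setOf_twoStageTest_snd_eq_one, inter_eq_left.2 subset_union_left] using hA
    · simpa [setOf_twoStageTest_snd_eq_zero, ← inter_assoc] using hA₂.compl.inter hB.compl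
    · simpa [setOf_twoStageTest_snd_eq_one, inter_union_distrib_left] using hA₂.compl.inter hB

lemma twoStageTest_mem_testClass {α β : ℝ} (h₁ : 1 ≤ n₁) (h₁₂ : n₁ ≤ n₂)
    (hA : MeasurableSet[obs S n₁] A) (hB : MeasurableSet[obs S n₂] B)
    (hα : (H.P 0).real A + (H.P 0).real B ≤ α) (hβ : (H.P 1).real Bᶜ ≤ β) :
    twoStageTest n₁ n₂ A B ∈ H.testClass α β := by
  refine ⟨isTest_twoStageTest h₁ h₁₂ hA hB, ?_, ?_⟩
  · rw [setOf_twoStageTest_snd_eq_one]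
    exact (measureReal_union_le _ _).trans hα
  · rw [setOf_twoStageTest_snd_eq_zero]
    exact (measureReal_mono inter_subset_right).trans hβ

lemma ess_twoStageTest_le (hA : MeasurableSet[obs S n₁] A) (i : Fin 2) :
    H.ess i (twoStageTest n₁ n₂ A B).1 ≤ n₁ + n₂ * H.P i Aᶜ :=
  calc _ ≤ ∫⁻ ω, ((n₁ : ℝ≥0∞) + Aᶜ.indicator (fun _ => (n₂ : ℝ≥0∞)) ω) ∂(H.P i) := by
        refine lintegral_mono fun ω => ?_
        by_cases hω : ω ∈ A <;> simp [twoStageTest, hω]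
    _ = _ := by
        rw [lintegral_add_left measurable_const,
          lintegral_indicator_const (obs_le _ _ hA).compl, lintegral_const, measure_univ, mul_one]

end TwoStage

variable {S : Type*} [MeasurableSpace S] {H : SimpleTesting S}

lemma ErrorsLE.optEss_one_le {n₁ n₂ : ℕ} {c₁ c₂ a₁ a₂ δ₁ δ₂ : ℝ} (h₁ : H.ErrorsLE n₁ c₁ a₁ δ₁)
    (h₂ : H.ErrorsLE n₂ c₂ a₂ δ₂) (hn₁ : 1 ≤ n₁) (hn : n₁ ≤ n₂) :
    H.optEss 1 (a₁ + a₂) δ₂ ≤ ENNReal.ofReal (n₁ + δ₁ * n₂) := by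
  have hmeas (n : ℕ) (c : ℝ) : MeasurableSet[obs S n] {ω | c < H.avgLlr n ω} :=
    H.measurable_avgLlr_obs n measurableSet_Ioi
  have hcompl (n : ℕ) (c : ℝ) : {ω | c < H.avgLlr n ω}ᶜ = {ω | H.avgLlr n ω ≤ c} := by
    ext ω
    simp
  have hδ₁ : 0 ≤ δ₁ := measureReal_nonneg.trans h₁.2
  refine (iInf₂_le _ (twoStageTest_mem_testClass hn₁ hn (hmeas n₁ c₁) (hmeas n₂ c₂)
    (add_le_add h₁.1 h₂.1) ?_)).trans ((ess_twoStageTest_le (hmeas n₁ c₁) 1).trans ?_)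
  · rw [hcompl]
    exact h₂.2
  · rw [hcompl, ENNReal.ofReal_add (Nat.cast_nonneg _) (by positivity), ENNReal.ofReal_mul hδ₁,
      ENNReal.ofReal_natCast, ENNReal.ofReal_natCast, ← ofReal_measureReal, mul_comm (n₂ : ℝ≥0∞)]
    gcongr
    exact h₁.2

namespace Regular

lemma exists_forall_errorsLE_of_mul_log_le (hH : H.Regular) : ∃ C > 0, ∃ c, ∀ (n : ℕ),
    ∀ a ∈ Ioo (0 : ℝ) 1, ∀ δ ∈ Ioo (0 : ℝ) 1, C * (-Real.log a + -Real.log δ) ≤ n →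
      H.ErrorsLE n c a δ := by
  have hI := hH.I_pos
  obtain ⟨ρ, hρ, c, herr⟩ := hH.exists_errorsLE (half_lt_self hI)
  refine ⟨max (1 / ρ) (2 / H.I 0), lt_max_of_lt_left (by positivity), c, fun n a ha δ hδ hn => ?_⟩
  have hloga : 0 < -Real.log a := neg_pos.2 (Real.log_neg ha.1 ha.2)
  have hlogδ : 0 < -Real.log δ := neg_pos.2 (Real.log_neg hδ.1 hδ.2)
  have hnull : 1 / ρ * -Real.log a ≤ n :=
    le_trans (by gcongr; exacts [le_max_left _ _, by linarith]) hn
  have halt : 2 / H.I 0 * -Real.log δ ≤ n :=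
    le_trans (by gcongr; exacts [le_max_right _ _, by linarith]) hn
  rw [div_mul_eq_mul_div, one_mul, div_le_iff₀' hρ] at hnull
  rw [div_mul_eq_mul_div, div_le_iff₀ hI] at halt
  exact herr n a δ ha.1 hδ.1 hnull (by linarith)

lemma exists_optEss_one_le (hH : H.Regular) : ∃ C > 0, ∀ α ∈ Ioo (0 : ℝ) 1, ∀ β ∈ Ioo (0 : ℝ) 1,
    H.optEss 1 α β ≤ ENNReal.ofReal
      (C * (1 + -Real.log α) + α * (C * (1 + -Real.log α + -Real.log β))) := by
  obtain ⟨C, hC, c, herr⟩ := hH.exists_forall_errorsLE_of_mul_log_le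
  refine ⟨2 * C + 1, by positivity, fun α hα β hβ => ?_⟩
  have hlogα : 0 < -Real.log α := neg_pos.2 (Real.log_neg hα.1 hα.2)
  have hlogβ : 0 < -Real.log β := neg_pos.2 (Real.log_neg hβ.1 hβ.2)
  have hlog2 : 0 < Real.log 2 := Real.log_pos one_lt_two
  have hlog2_lt : Real.log 2 < 1 := Real.log_two_lt_d9.trans (by norm_num)
  have hα2 : α / 2 ∈ Ioo (0 : ℝ) 1 := ⟨half_pos hα.1, (half_lt_self hα.1).trans hα.2⟩
  have hhalf : -Real.log (α / 2) = -Real.log α + Real.log 2 := by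
    rw [Real.log_div hα.1.ne' two_ne_zero]
    ring
  set u := C * (-Real.log (α / 2) + -Real.log α) with hu
  set v := C * (-Real.log (α / 2) + -Real.log α + -Real.log β) with hv
  have hu_pos : 0 < u := mul_pos hC (by linarith)
  have huv : u ≤ v := mul_le_mul_of_nonneg_left (by linarith) hC.le
  have hle_v : C * (-Real.log (α / 2) + -Real.log β) ≤ v :=
    mul_le_mul_of_nonneg_left (by linarith) hC.le
  have hopt : H.optEss 1 (α / 2 + α / 2) β ≤ ENNReal.ofReal (⌈u⌉₊ + α * ⌈v⌉₊) :=
    (herr ⌈u⌉₊ _ hα2 _ hα (Nat.le_ceil u)).optEss_one_le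
      (herr ⌈v⌉₊ _ hα2 _ hβ (hle_v.trans (Nat.le_ceil v))) (Nat.one_le_ceil_iff.2 hu_pos)
      (Nat.ceil_mono huv)
  rw [add_halves] at hopt
  have hceil_u := (Nat.ceil_lt_add_one hu_pos.le).le
  have hceil_v := (Nat.ceil_lt_add_one (hu_pos.le.trans huv)).le
  rw [hhalf] at hu hv
  refine hopt.trans (ENNReal.ofReal_le_ofReal
    (add_le_add ?_ (mul_le_mul_of_nonneg_left ?_ hα.1.le)))
  · nlinarith
  · nlinarith

end Regular
end SimpleTesting

/-! ### Calculus of the asymptotic relations -/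

section Asymptotics

variable {ι : Type*} {l : Filter ι} {x y z c : ι → ℝ≥0∞} {u : ι → ℝ}

namespace AsympEquiv

lemma symm (h : AsympEquiv l x y) : AsympEquiv l y x := by
  have hinv : Tendsto (fun p => (x p / y p)⁻¹) l (𝓝 1) := by simpa using tendsto_inv_iff.2 h
  refine hinv.congr' ?_
  filter_upwards [Tendsto.eventually_ne h one_ne_zero] with p hp
  obtain ⟨hx, hy⟩ := ENNReal.div_ne_zero.1 hp
  exact ENNReal.inv_div (Or.inl hy) (Or.inr hx)

lemma trans (hxy : AsympEquiv l x y) (hyz : AsympEquiv l y z) : AsympEquiv l x z := by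
  have hmul : Tendsto (fun p => x p / y p * (y p / z p)) l (𝓝 1) := by
    simpa using ENNReal.Tendsto.mul hxy (Or.inl one_ne_zero) hyz (Or.inl one_ne_zero)
  refine hmul.congr' ?_
  filter_upwards [Tendsto.eventually_ne hxy one_ne_zero,
    Tendsto.eventually_ne hyz one_ne_zero] with p hxp hyp
  rw [← mul_div_assoc, ENNReal.div_mul_cancel (ENNReal.div_ne_zero.1 hyp).1
    (ENNReal.div_ne_zero.1 hxp).2]

lemma mul_left (h : AsympEquiv l x y) (hc : ∀ p, c p ≠ 0) (hc_top : ∀ p, c p ≠ ∞) :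
    AsympEquiv l (fun p => c p * x p) (fun p => c p * y p) :=
  Tendsto.congr (fun p => (ENNReal.mul_div_mul_left _ _ (hc p) (hc_top p)).symm) h

lemma of_bounds (hu : ∀ᶠ p in l, 0 < u p)
    (h : ∀ ε ∈ Ioo (0 : ℝ) 1, ∀ᶠ p in l, ENNReal.ofReal ((1 - ε) * u p) ≤ x p ∧
      x p ≤ ENNReal.ofReal ((1 + ε) * u p)) :
    AsympEquiv l x fun p => ENNReal.ofReal (u p) := by
  refine (ENNReal.tendsto_nhds ENNReal.one_ne_top).2 fun e he => ?_
  obtain ⟨ε, hε_pos, hε⟩ := ENNReal.lt_iff_exists_nnreal_btwn.1 (lt_min he one_pos)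
  have hε_mem : (ε : ℝ) ∈ Ioo (0 : ℝ) 1 :=
    ⟨by exact_mod_cast hε_pos, by exact_mod_cast hε.trans_le (min_le_right _ _)⟩
  have hεe : ENNReal.ofReal ε ≤ e := by
    rw [ENNReal.ofReal_coe_nnreal]
    exact (hε.trans_le (min_le_left _ _)).le
  filter_upwards [hu, h ε hε_mem] with p hp ⟨hlower, hupper⟩
  have hU : ENNReal.ofReal (u p) ≠ 0 := ENNReal.ofReal_ne_zero_iff.2 hp
  rw [ENNReal.ofReal_mul (by linarith [hε_mem.2])] at hlower
  rw [ENNReal.ofReal_mul (by linarith [hε_mem.1])] at hupper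
  constructor
  · rw [ENNReal.le_div_iff_mul_le (Or.inl hU) (Or.inl ENNReal.ofReal_ne_top)]
    refine le_trans (mul_le_mul' ?_ le_rfl) hlower
    rw [ENNReal.ofReal_sub _ hε_mem.1.le, ENNReal.ofReal_one]
    exact tsub_le_tsub_left hεe 1
  · rw [ENNReal.div_le_iff_le_mul (Or.inl hU) (Or.inl ENNReal.ofReal_ne_top)]
    refine hupper.trans (mul_le_mul' ?_ le_rfl)
    rw [ENNReal.ofReal_add zero_le_one hε_mem.1.le, ENNReal.ofReal_one]
    gcongr

end AsympEquiv

lemma AsympLE.of_bounds (h : ∀ ε ∈ Ioo (0 : ℝ) 1, ∀ᶠ p in l,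
    x p ≤ ENNReal.ofReal ((1 + ε) * u p)) : AsympLE l x fun p => ENNReal.ofReal (u p) := by
  refine ENNReal.le_of_forall_pos_le_add fun e he _ => ?_
  set ε : ℝ := min e (1 / 2)
  have hε : ε ∈ Ioo (0 : ℝ) 1 := ⟨by positivity, (min_le_right _ _).trans_lt (by norm_num)⟩
  refine limsup_le_of_le (by isBoundedDefault) ?_
  filter_upwards [h ε hε] with p hp
  refine ENNReal.div_le_of_le_mul (hp.trans ?_)
  rw [ENNReal.ofReal_mul (by linarith [hε.1]), ENNReal.ofReal_add zero_le_one hε.1.le,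
    ENNReal.ofReal_one]
  gcongr
  rw [← ENNReal.ofReal_coe_nnreal]
  exact ENNReal.ofReal_le_ofReal (min_le_left _ _)

lemma MuchGreater.mul_left (h : MuchGreater l x y) (hc : ∀ p, c p ≠ 0) (hc_top : ∀ p, c p ≠ ∞) :
    MuchGreater l (fun p => c p * x p) (fun p => c p * y p) :=
  Tendsto.congr (fun p => (ENNReal.mul_div_mul_left _ _ (hc p) (hc_top p)).symm) h

lemma MuchGreater.of_bounds (hu : ∀ᶠ p in l, 0 < u p)
    (h : ∀ ε > 0, ∀ᶠ p in l, y p ≤ ENNReal.ofReal (ε * u p)) :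
    MuchGreater l (fun p => ENNReal.ofReal (u p)) y := by
  refine ENNReal.tendsto_nhds_top fun n => ?_
  filter_upwards [hu, h (1 / (n + 1)) (by positivity)] with p hup hp
  have hpos : 0 < 1 / ((n : ℝ) + 1) * u p := by positivity
  calc (n : ℝ≥0∞) < ENNReal.ofReal (n + 1) := by
        rw [← ENNReal.ofReal_natCast, ENNReal.ofReal_lt_ofReal_iff (by positivity)]
        linarith
    _ = ENNReal.ofReal (u p) / ENNReal.ofReal (1 / (n + 1) * u p) := by
        rw [← ENNReal.ofReal_div_of_pos hpos]
        congr 1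
        field_simp
    _ ≤ _ := ENNReal.div_le_div_left hp _

end Asymptotics

namespace SimpleTesting

/-! ### The regime of small errors -/

lemma abs_log_of_mem_Ioo {x : ℝ} (hx : x ∈ Ioo (0 : ℝ) 1) : |Real.log x| = -Real.log x :=
  abs_of_neg (Real.log_neg hx.1 hx.2)

lemma eventually_fst_smallErrors {p : ℝ → Prop} (h : ∀ᶠ α in 𝓝[>] (0 : ℝ), p α) :
    ∀ᶠ q in smallErrors, p q.1 :=
  tendsto_fst.eventually h

lemma eventually_snd_smallErrors {p : ℝ → Prop} (h : ∀ᶠ β in 𝓝[>] (0 : ℝ), p β) :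
    ∀ᶠ q in smallErrors, p q.2 :=
  tendsto_snd.eventually h

lemma eventually_mem_Ioo_smallErrors :
    ∀ᶠ p in smallErrors, p.1 ∈ Ioo (0 : ℝ) 1 ∧ p.2 ∈ Ioo (0 : ℝ) 1 :=
  (eventually_fst_smallErrors (Ioo_mem_nhdsGT one_pos)).and
    (eventually_snd_smallErrors (Ioo_mem_nhdsGT one_pos))

section NumberOfStages

variable {K : ℝ → ℝ → ℕ}

lemma eventually_rootLevel_mem_Ioo
    (hK : ∀ α ∈ Ioo (0 : ℝ) 1, ∀ β ∈ Ioo (0 : ℝ) 1, 1 ≤ K α β) :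
    ∀ᶠ p in smallErrors, p.1 ^ (1 / (K p.1 p.2 : ℝ)) ∈ Ioo (0 : ℝ) 1 := by
  filter_upwards [eventually_mem_Ioo_smallErrors] with p hp
  exact rootLevel_mem_Ioo hp.1 (hK _ hp.1 _ hp.2)

lemma tendsto_rootLevel_iff
    (hK : ∀ α ∈ Ioo (0 : ℝ) 1, ∀ β ∈ Ioo (0 : ℝ) 1, 1 ≤ K α β) :
    Tendsto (fun p : ℝ × ℝ => p.1 ^ (1 / (K p.1 p.2 : ℝ))) smallErrors (𝓝 0) ↔
      MuchLess smallErrors (fun p => (K p.1 p.2 : ℝ)) (fun p => |Real.log p.1|) := by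
  have hroot := eventually_rootLevel_mem_Ioo hK
  have hlog : (fun p : ℝ × ℝ => (K p.1 p.2 : ℝ) / |Real.log p.1|) =ᶠ[smallErrors]
      fun p => (-Real.log (p.1 ^ (1 / (K p.1 p.2 : ℝ))))⁻¹ := by
    filter_upwards [eventually_mem_Ioo_smallErrors] with p hp
    rw [abs_log_of_mem_Ioo hp.1, Real.log_rpow hp.1.1, ← mul_neg, mul_inv, one_div, inv_inv,
      div_eq_mul_inv]
  rw [MuchLess, tendsto_congr' hlog]
  constructor
  · intro h
    exact tendsto_inv_atTop_zero.comp (tendsto_neg_log_nhdsGT_zero.comp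
      (tendsto_nhdsWithin_iff.2 ⟨h, hroot.mono fun p hp => hp.1⟩))
  · intro h
    have hinv : ∀ᶠ p in smallErrors, (-Real.log (p.1 ^ (1 / (K p.1 p.2 : ℝ))))⁻¹ ∈ Ioi (0 : ℝ) :=
      hroot.mono fun p hp => inv_pos.2 (neg_pos.2 (Real.log_neg hp.1 hp.2))
    refine (Real.tendsto_exp_neg_atTop_nhds_zero.comp (tendsto_inv_nhdsGT_zero.comp
      (tendsto_nhdsWithin_iff.2 ⟨h, hinv⟩))).congr' ?_
    filter_upwards [hroot] with p hp
    simp only [Function.comp_apply, inv_inv, neg_neg, Real.exp_log hp.1]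

lemma muchLess_log_rootLevel_iff :
    MuchLess smallErrors (fun p => |Real.log (p.1 ^ (1 / (K p.1 p.2 : ℝ)))|)
        (fun p => |Real.log p.2|) ↔
      MuchLess smallErrors (fun p => |Real.log p.1| / |Real.log p.2|)
        (fun p => (K p.1 p.2 : ℝ)) := by
  refine tendsto_congr' ?_
  filter_upwards [eventually_mem_Ioo_smallErrors] with p hp
  rw [Real.log_rpow hp.1.1, abs_mul, abs_of_nonneg (by positivity : 0 ≤ 1 / (K p.1 p.2 : ℝ))]
  ring

end NumberOfStages

/-- The condition of the theorem on the number `K α β` of stages. -/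
structure AdmissibleStages (K : ℝ → ℝ → ℕ) : Prop where
  one_le : ∀ α ∈ Ioo (0 : ℝ) 1, ∀ β ∈ Ioo (0 : ℝ) 1, 1 ≤ K α β
  tendsto_rootLevel : Tendsto (fun p : ℝ × ℝ => p.1 ^ (1 / (K p.1 p.2 : ℝ))) smallErrors (𝓝 0)
  muchLess_log_rootLevel : MuchLess smallErrors
    (fun p => |Real.log (p.1 ^ (1 / (K p.1 p.2 : ℝ)))|) (fun p => |Real.log p.2|)

lemma AdmissibleStages.eventually_mem {K : ℝ → ℝ → ℕ} (hK : AdmissibleStages K) :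
    ∀ᶠ p in smallErrors, p.1 ∈ Ioo (0 : ℝ) 1 ∧ p.2 ∈ Ioo (0 : ℝ) 1 ∧ 1 ≤ K p.1 p.2 :=
  eventually_mem_Ioo_smallErrors.mono fun _ hp => ⟨hp.1, hp.2, hK.one_le _ hp.1 _ hp.2⟩

variable {S : Type*} [MeasurableSpace S] {H : SimpleTesting S}

lemma log_div_pos {I β : ℝ} (hI : 0 < I) (hβ : β ∈ Ioo (0 : ℝ) 1) : 0 < |Real.log β| / I :=
  div_pos (abs_pos.2 (Real.log_neg hβ.1 hβ.2).ne) hI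

lemma eventually_log_div_pos {I : ℝ} (hI : 0 < I) :
    ∀ᶠ p : ℝ × ℝ in smallErrors, 0 < |Real.log p.2| / I :=
  eventually_mem_Ioo_smallErrors.mono fun _ hp => log_div_pos hI hp.2

lemma tendsto_neg_log_half_nhdsGT_zero :
    Tendsto (fun β : ℝ => -Real.log (β / 2)) (𝓝[>] 0) atTop := by
  refine tendsto_neg_log_nhdsGT_zero.comp (tendsto_nhdsWithin_iff.2 ⟨?_, ?_⟩)
  · exact Tendsto.mono_left (by simpa using (continuous_id.div_const (2 : ℝ)).tendsto 0)
      nhdsWithin_le_nhds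
  · filter_upwards [self_mem_nhdsWithin] with β hβ using half_pos (mem_Ioi.1 hβ)

lemma eventually_neg_log_half_div_add_one_le {I ε : ℝ} (hI : 0 < I) (hε : 0 < ε) :
    ∀ᶠ β in 𝓝[>] (0 : ℝ), -Real.log (β / 2) / (I / (1 + ε / 2)) + 1 ≤
      (1 + ε) * (|Real.log β| / I) := by
  filter_upwards [Ioo_mem_nhdsGT one_pos, tendsto_neg_log_nhdsGT_zero.eventually_ge_atTop
    (((1 + ε / 2) * Real.log 2 + I) / (ε / 2))] with β hβ hlarge
  rw [div_le_iff₀ (by positivity)] at hlarge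
  have hlhs : -Real.log (β / 2) / (I / (1 + ε / 2)) + 1 =
      ((1 + ε / 2) * (-Real.log β + Real.log 2) + I) / I := by
    rw [Real.log_div hβ.1.ne' two_ne_zero]
    field_simp
    ring
  rw [hlhs, abs_log_of_mem_Ioo hβ, ← mul_div_assoc]
  gcongr
  linarith

/-! ### Optimality under the null -/

namespace Regular

lemma exists_sizeSuffices (hH : H.Regular) {κ : ℝ} (hκ : κ ∈ Ioo 0 (H.I 0)) :
    ∃ ρ > 0, ∃ c, ∀ (α β : ℝ) (K : ℕ), 0 < α → 0 < β →
      -Real.log (α ^ (1 / (K : ℝ))) ≤ ρ * -Real.log (β / 2) →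
      H.SizeSuffices α β K (-Real.log (β / 2) / κ) c := by
  obtain ⟨ρ, hρ, c, herr⟩ := hH.exists_errorsLE hκ.2
  have hκ0 := hκ.1
  refine ⟨ρ / κ, by positivity, c, fun α β K hα hβ hlog j N _ hN => ?_⟩
  rw [← mul_div_assoc, div_le_iff₀ hκ0] at hN
  refine herr N _ _ (pow_pos (Real.rpow_pos_of_pos hα _) j) (pow_pos (half_pos hβ) j) ?_ ?_
  · rw [Real.log_pow]
    calc -(j * Real.log (α ^ (1 / (K : ℝ)))) ≤ j * (ρ / κ * -Real.log (β / 2)) := by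
          rw [← mul_neg]
          gcongr
      _ = ρ / κ * (j * -Real.log (β / 2)) := by ring
      _ ≤ ρ / κ * (N * κ) := by gcongr
      _ = ρ * N := by field_simp
  · rw [Real.log_pow]
    linarith

lemma eventually_exists_sizeSuffices (hH : H.Regular) {K : ℝ → ℝ → ℕ} (hK : AdmissibleStages K)
    {ε : ℝ} (hε : 0 < ε) (R : ℝ) :
    ∀ᶠ p in smallErrors, ∃ B c : ℝ, R ≤ B ∧ H.SizeSuffices p.1 p.2 (K p.1 p.2) B c ∧
      B + 1 ≤ (1 + ε) * (|Real.log p.2| / H.I 0) := by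
  have hI := hH.I_pos
  have hκ : 0 < H.I 0 / (1 + ε / 2) := by positivity
  obtain ⟨ρ, hρ, c, hsuff⟩ := hH.exists_sizeSuffices ⟨hκ, div_lt_self hI (by linarith)⟩
  filter_upwards [hK.eventually_mem, hK.muchLess_log_rootLevel.eventually_lt_const hρ,
    eventually_rootLevel_mem_Ioo hK.one_le,
    eventually_snd_smallErrors (eventually_neg_log_half_div_add_one_le hI hε),
    eventually_snd_smallErrors
      ((tendsto_neg_log_half_nhdsGT_zero.atTop_div_const hκ).eventually_ge_atTop R)]
    with p ⟨hα, hβ, _⟩ hlog hroot hB hR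
  refine ⟨_, c, hR, hsuff _ _ _ hα.1 hβ.1 ?_, hB⟩
  have hlogβ : 0 < -Real.log p.2 := neg_pos.2 (Real.log_neg hβ.1 hβ.2)
  rw [abs_log_of_mem_Ioo hroot, abs_log_of_mem_Ioo hβ, div_lt_iff₀ hlogβ] at hlog
  refine hlog.le.trans ?_
  gcongr
  · exact half_pos hβ.1
  · linarith [hβ.1]

lemma eventually_le_optEss_zero (hH : H.Regular) {ε : ℝ} (hε : ε ∈ Ioo (0 : ℝ) 1) :
    ∀ᶠ p in smallErrors,
      ENNReal.ofReal ((1 - ε) * (|Real.log p.2| / H.I 0)) ≤ H.optEss 0 p.1 p.2 := by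
  have hε3 : ε / 3 ∈ Ioo (0 : ℝ) 1 := ⟨by linarith [hε.1], by linarith [hε.2]⟩
  filter_upwards [eventually_mem_Ioo_smallErrors,
    eventually_fst_smallErrors (Ioo_mem_nhdsGT hε3.1),
    eventually_snd_smallErrors (hH.eventually_converseAt hε3)] with p ⟨_, hβ⟩ hα hconv
  refine le_trans (ENNReal.ofReal_le_ofReal ?_)
    (hconv.le_optEss hH.I_pos (by linarith [hε.2]) hα.2.le hβ)
  rw [← abs_log_of_mem_Ioo hβ, ← mul_assoc]
  refine mul_le_mul_of_nonneg_right ?_ (log_div_pos hH.I_pos hβ).le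
  nlinarith [hε.1]

lemma asympOptimalNull_of_ess_zero_le (hH : H.Regular)
    {χ : ℝ → ℝ → ((ℕ → S) → ℕ∞) × ((ℕ → S) → Fin 2)}
    (hχ : ∀ α ∈ Ioo (0 : ℝ) 1, ∀ β ∈ Ioo (0 : ℝ) 1, χ α β ∈ H.testClass α β)
    (hle : ∀ ε ∈ Ioo (0 : ℝ) 1, ∀ᶠ p in smallErrors,
      H.ess 0 (χ p.1 p.2).1 ≤ ENNReal.ofReal ((1 + ε) * (|Real.log p.2| / H.I 0))) :
    H.AsympOptimalNull χ := by
  have hscale := eventually_log_div_pos hH.I_pos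
  have hopt : ∀ᶠ p in smallErrors, H.optEss 0 p.1 p.2 ≤ H.ess 0 (χ p.1 p.2).1 :=
    eventually_mem_Ioo_smallErrors.mono fun p hp => iInf₂_le _ (hχ _ hp.1 _ hp.2)
  refine ⟨hχ, .trans (.of_bounds hscale fun ε hε => ?_)
    (AsympEquiv.of_bounds hscale fun ε hε => ?_).symm⟩
  · filter_upwards [hH.eventually_le_optEss_zero hε, hopt, hle ε hε] with p hlower hopt hupper
    exact ⟨hlower.trans hopt, hupper⟩
  · filter_upwards [hH.eventually_le_optEss_zero hε, hopt, hle ε hε] with p hlower hopt hupper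
    exact ⟨hlower, hopt.trans hupper⟩

lemma asympOptimalNull_of_sizeSuffices (hH : H.Regular) {K : ℝ → ℝ → ℕ} (hK : AdmissibleStages K)
    {χ : ℝ → ℝ → ((ℕ → S) → ℕ∞) × ((ℕ → S) → Fin 2)} (R : ℝ)
    (hχ : ∀ α ∈ Ioo (0 : ℝ) 1, ∀ β ∈ Ioo (0 : ℝ) 1, χ α β ∈ H.testClass α β)
    (hle : ∀ α ∈ Ioo (0 : ℝ) 1, ∀ β ∈ Ioo (0 : ℝ) 1, ∀ B c : ℝ, R ≤ B →
      H.SizeSuffices α β (K α β) B c → α ^ (1 / (K α β : ℝ)) ≤ 1 / 8 →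
      H.ess 0 (χ α β).1 ≤ ENNReal.ofReal ((B + 1) * (1 + 8 * α ^ (1 / (K α β : ℝ))))) :
    H.AsympOptimalNull χ := by
  refine hH.asympOptimalNull_of_ess_zero_le hχ fun ε ⟨hε0, hε1⟩ => ?_
  filter_upwards [hK.eventually_mem,
    hH.eventually_exists_sizeSuffices hK (by linarith : 0 < ε / 3) R,
    eventually_rootLevel_mem_Ioo hK.one_le,
    hK.tendsto_rootLevel.eventually_le_const (by linarith : 0 < ε / 24)]
    with p ⟨hα, hβ, _⟩ ⟨B, c, hRB, hsuff, hB⟩ hroot hsmall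
  refine (hle _ hα _ hβ B c hRB hsuff (by linarith)).trans (ENNReal.ofReal_le_ofReal ?_)
  have hscale := log_div_pos hH.I_pos hβ
  calc _ ≤ (1 + ε / 3) * (|Real.log p.2| / H.I 0) * (1 + ε / 3) := by
        have hroot0 := hroot.1
        gcongr
        linarith
    _ = (1 + ε / 3) * (1 + ε / 3) * (|Real.log p.2| / H.I 0) := by ring
    _ ≤ _ := by
        gcongr
        nlinarith

lemma asympOptimalNull_ST (hH : H.Regular) {K : ℝ → ℝ → ℕ} (hK : AdmissibleStages K) :
    H.AsympOptimalNull fun α β => H.ST α β (K α β) :=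
  hH.asympOptimalNull_of_sizeSuffices hK 1
    (fun α hα β hβ => hH.ST_mem_testClass hα hβ (hK.one_le α hα β hβ))
    fun α hα β hβ _ _ hB hsuff =>
      hsuff.ess_zero_ST_le hH hα hβ (hK.one_le α hα β hβ) (one_pos.trans_le hB)

lemma asympOptimalNull_modST (hH : H.Regular) {K : ℝ → ℝ → ℕ} (hK : AdmissibleStages K) (r : ℕ) :
    H.AsympOptimalNull fun α β => H.modST r α β (K α β) :=
  hH.asympOptimalNull_of_sizeSuffices hK (max 1 r)
    (fun α hα β hβ => hH.modST_mem_testClass r hα hβ (hK.one_le α hα β hβ))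
    fun α hα β hβ _ _ hB hsuff => hsuff.ess_zero_modST_le hH hα hβ (hK.one_le α hα β hβ)
      (one_pos.trans_le ((le_max_left _ _).trans hB)) ((le_max_right _ _).trans hB)

/-! ### Performance under the alternative -/

lemma eventually_forall_converseAt (hH : H.Regular) {ε : ℝ} (hε : ε ∈ Ioo (0 : ℝ) 1) :
    ∀ᶠ β in 𝓝[>] (0 : ℝ), ∀ δ ∈ Ioc 0 β, H.ConverseAt ε δ := by
  obtain ⟨η, hη, hconv⟩ := mem_nhdsGT_iff_exists_Ioo_subset.1 (hH.eventually_converseAt hε)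
  filter_upwards [Ioo_mem_nhdsGT hη] with β hβ δ hδ using hconv ⟨hδ.1, hδ.2.trans_lt hβ.2⟩

lemma asympEquiv_ess_one_ST (hH : H.Regular) {K : ℝ → ℝ → ℕ} (hK : AdmissibleStages K) :
    AsympEquiv smallErrors (fun p => H.ess 1 (H.ST p.1 p.2 (K p.1 p.2)).1)
      (fun p => ENNReal.ofReal
        ((K p.1 p.2 : ℝ) * ((K p.1 p.2 : ℝ) + 1) / 2 * (|Real.log p.2| / H.I 0))) := by
  have hscale : ∀ᶠ p in smallErrors,
      0 < (K p.1 p.2 : ℝ) * ((K p.1 p.2 : ℝ) + 1) / 2 * (|Real.log p.2| / H.I 0) := by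
    filter_upwards [hK.eventually_mem] with p ⟨_, hβ, hone⟩
    exact mul_pos (by positivity) (log_div_pos hH.I_pos hβ)
  refine .of_bounds hscale fun ε hε => ?_
  have hε2 : ε / 2 ∈ Ioo (0 : ℝ) 1 := ⟨half_pos hε.1, by linarith [hε.2]⟩
  filter_upwards [hK.eventually_mem, hscale, eventually_snd_smallErrors (Ioo_mem_nhdsGT hε2.1),
    eventually_snd_smallErrors (hH.eventually_forall_converseAt hε2),
    hH.eventually_exists_sizeSuffices hK hε.1 1,
    hK.tendsto_rootLevel.eventually_lt_const (sub_pos.2 hε2.2)]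
    with p ⟨hα, hβ, hone⟩ hscale hβε hconv ⟨B, c, hB1, hsuff, hB⟩ hroot
  constructor
  · refine le_trans (ENNReal.ofReal_le_ofReal ?_)
      (hH.le_ess_one_ST hε2.2.le hα hβ hone hroot hconv)
    rw [← abs_log_of_mem_Ioo hβ, mul_right_comm]
    refine mul_le_mul_of_nonneg_right ?_ hscale.le
    nlinarith [hβε.1, hβε.2]
  · refine (hsuff.ess_one_ST_le hH hα hβ hone (one_pos.trans_le hB1)).trans
      (ENNReal.ofReal_le_ofReal ?_)
    rw [mul_left_comm]
    gcongr

lemma asympLE_ess_one_modST (hH : H.Regular) {K : ℝ → ℝ → ℕ} (hK : AdmissibleStages K) (r : ℕ) :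
    AsympLE smallErrors (fun p => H.ess 1 (H.modST r p.1 p.2 (K p.1 p.2)).1)
      (fun p => ENNReal.ofReal ((K p.1 p.2 : ℝ) * (|Real.log p.2| / H.I 0))) := by
  refine .of_bounds fun ε hε => ?_
  filter_upwards [hK.eventually_mem, hH.eventually_exists_sizeSuffices hK hε.1 (max 1 r)]
    with p ⟨hα, hβ, hone⟩ ⟨B, c, hBr, hsuff, hB⟩
  refine (hsuff.ess_one_modST_le hH hα hβ hone (one_pos.trans_le ((le_max_left _ _).trans hBr))
    ((le_max_right _ _).trans hBr)).trans (ENNReal.ofReal_le_ofReal ?_)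
  rw [mul_left_comm]
  gcongr

lemma eventually_optEss_one_le (hH : H.Regular) {K : ℝ → ℝ → ℕ} (hK : AdmissibleStages K)
    {ε : ℝ} (hε : 0 < ε) :
    ∀ᶠ p in smallErrors, H.optEss 1 p.1 p.2 ≤
      ENNReal.ofReal (ε * ((K p.1 p.2 : ℝ) * (|Real.log p.2| / H.I 0))) := by
  have hI := hH.I_pos
  obtain ⟨C, hC, hopt⟩ := hH.exists_optEss_one_le
  set κ := min 1 (ε / (5 * C * H.I 0))
  have hκ : 0 < κ := by positivity
  have hκε : κ * (5 * C * H.I 0) ≤ ε := (le_div_iff₀ (by positivity)).1 (min_le_right _ _)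
  filter_upwards [hK.eventually_mem, eventually_fst_smallErrors (Ioo_mem_nhdsGT hκ),
    (muchLess_log_rootLevel_iff.1 hK.muchLess_log_rootLevel).eventually_lt_const hκ,
    eventually_snd_smallErrors (tendsto_neg_log_nhdsGT_zero.eventually_ge_atTop (1 / κ))]
    with p ⟨hα, hβ, hone⟩ hακ hlog hlarge
  refine (hopt _ hα _ hβ).trans (ENNReal.ofReal_le_ofReal ?_)
  have hK1 : (1 : ℝ) ≤ K p.1 p.2 := by exact_mod_cast hone
  have hlogβ : 0 < -Real.log p.2 := neg_pos.2 (Real.log_neg hβ.1 hβ.2)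
  have hlogα : 0 < -Real.log p.1 := neg_pos.2 (Real.log_neg hα.1 hα.2)
  rw [abs_log_of_mem_Ioo hα, abs_log_of_mem_Ioo hβ, div_div, div_lt_iff₀ (by positivity),
    mul_comm (-Real.log p.2)] at hlog
  rw [abs_log_of_mem_Ioo hβ, ← mul_div_assoc, ← mul_div_assoc, le_div_iff₀ hI]
  set x := (K p.1 p.2 : ℝ) * -Real.log p.2
  have hx : -Real.log p.2 ≤ x := le_mul_of_one_le_left hlogβ.le hK1
  have hone_le : 1 ≤ κ * x := (div_le_iff₀' hκ).1 (hlarge.trans hx)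
  have hlate : p.1 * (1 + -Real.log p.1 + -Real.log p.2) ≤ (1 + -Real.log p.1) + κ * x := by
    nlinarith [hακ.1, hακ.2, hα.2]
  calc _ = C * ((1 + -Real.log p.1) + p.1 * (1 + -Real.log p.1 + -Real.log p.2)) * H.I 0 := by ring
    _ ≤ C * (5 * (κ * x)) * H.I 0 := by
        gcongr
        linarith
    _ = κ * (5 * C * H.I 0) * x := by ring
    _ ≤ ε * x := mul_le_mul_of_nonneg_right hκε (hlogβ.le.trans hx)

lemma muchGreater_optEss_one (hH : H.Regular) {K : ℝ → ℝ → ℕ} (hK : AdmissibleStages K) :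
    MuchGreater smallErrors
      (fun p => ENNReal.ofReal
        ((K p.1 p.2 : ℝ) * ((K p.1 p.2 : ℝ) + 1) / 2 * (|Real.log p.2| / H.I 0)))
      (fun p => ENNReal.ofReal (((K p.1 p.2 : ℝ) + 1) / 2) * H.optEss 1 p.1 p.2) := by
  have hfactor (p : ℝ × ℝ) : 0 < ((K p.1 p.2 : ℝ) + 1) / 2 := by positivity
  have hscale : ∀ᶠ p in smallErrors, 0 < (K p.1 p.2 : ℝ) * (|Real.log p.2| / H.I 0) := by
    filter_upwards [hK.eventually_mem] with p ⟨_, hβ, hone⟩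
    exact mul_pos (by positivity) (log_div_pos hH.I_pos hβ)
  convert (MuchGreater.of_bounds hscale fun ε hε => hH.eventually_optEss_one_le hK hε).mul_left
    (fun p => ENNReal.ofReal_ne_zero_iff.2 (hfactor p)) (fun _ => ENNReal.ofReal_ne_top)
    using 2 with p
  rw [← ENNReal.ofReal_mul (hfactor p).le]
  ring_nf

lemma asympEquiv_two_div_mul_ess_one_ST (hH : H.Regular) {K : ℝ → ℝ → ℕ}
    (hK : AdmissibleStages K) :
    AsympEquiv smallErrors
      (fun p => ENNReal.ofReal ((K p.1 p.2 : ℝ) * (|Real.log p.2| / H.I 0)))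
      (fun p => ENNReal.ofReal (2 / ((K p.1 p.2 : ℝ) + 1)) *
        H.ess 1 (H.ST p.1 p.2 (K p.1 p.2)).1) := by
  have hfactor (p : ℝ × ℝ) : 0 < 2 / ((K p.1 p.2 : ℝ) + 1) := by positivity
  convert (hH.asympEquiv_ess_one_ST hK).symm.mul_left
    (fun p => ENNReal.ofReal_ne_zero_iff.2 (hfactor p)) (fun _ => ENNReal.ofReal_ne_top)
    using 2 with p
  rw [← ENNReal.ofReal_mul (hfactor p).le]
  congr 1
  field_simp

end Regular
end SimpleTesting

theorem mainTheorem4_general {S : Type*} [MeasurableSpace S] (H : SimpleTesting S)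
    (hI0 : 0 < H.kl 0 ∧ H.kl 0 < ∞) (hac : H.law 1 ≪ H.law 0) (r : ℕ)
    (K : ℝ → ℝ → ℕ) (hK : ∀ α ∈ Ioo (0 : ℝ) 1, ∀ β ∈ Ioo (0 : ℝ) 1, 1 ≤ K α β) :
    ((Tendsto (fun p : ℝ × ℝ => p.1 ^ (1 / (K p.1 p.2 : ℝ))) smallErrors (𝓝 0) ∧
        MuchLess smallErrors (fun p => |Real.log (p.1 ^ (1 / (K p.1 p.2 : ℝ)))|)
          (fun p => |Real.log p.2|)) ↔
      (MuchLess smallErrors (fun p => |Real.log p.1| / |Real.log p.2|)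
          (fun p => (K p.1 p.2 : ℝ)) ∧
        MuchLess smallErrors (fun p => (K p.1 p.2 : ℝ)) (fun p => |Real.log p.1|))) ∧
    (MuchLess smallErrors (fun p => |Real.log p.1| / |Real.log p.2|)
        (fun p => (K p.1 p.2 : ℝ)) →
      MuchLess smallErrors (fun p => (K p.1 p.2 : ℝ)) (fun p => |Real.log p.1|) →
      H.AsympOptimalNull (fun α β => H.ST α β (K α β)) ∧
      H.AsympOptimalNull (fun α β => H.modST r α β (K α β)) ∧
      AsympEquiv smallErrors
        (fun p => H.ess 1 (H.ST p.1 p.2 (K p.1 p.2)).1)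
        (fun p => ENNReal.ofReal
          ((K p.1 p.2 : ℝ) * ((K p.1 p.2 : ℝ) + 1) / 2 * (|Real.log p.2| / H.I 0))) ∧
      MuchGreater smallErrors
        (fun p => ENNReal.ofReal
          ((K p.1 p.2 : ℝ) * ((K p.1 p.2 : ℝ) + 1) / 2 * (|Real.log p.2| / H.I 0)))
        (fun p => ENNReal.ofReal (((K p.1 p.2 : ℝ) + 1) / 2) * H.optEss 1 p.1 p.2) ∧
      AsympLE smallErrors
        (fun p => H.ess 1 (H.modST r p.1 p.2 (K p.1 p.2)).1)
        (fun p => ENNReal.ofReal ((K p.1 p.2 : ℝ) * (|Real.log p.2| / H.I 0))) ∧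
      AsympEquiv smallErrors
        (fun p => ENNReal.ofReal ((K p.1 p.2 : ℝ) * (|Real.log p.2| / H.I 0)))
        (fun p => ENNReal.ofReal (2 / ((K p.1 p.2 : ℝ) + 1)) *
          H.ess 1 (H.ST p.1 p.2 (K p.1 p.2)).1)) := by
  have hH : H.Regular := ⟨hI0.1, hI0.2, hac⟩
  have root_iff := SimpleTesting.tendsto_rootLevel_iff hK
  have log_iff := SimpleTesting.muchLess_log_rootLevel_iff (K := K)
  refine ⟨(and_congr root_iff log_iff).trans and_comm, fun hlower hupper => ?_⟩
  have hadm : SimpleTesting.AdmissibleStages K := ⟨hK, root_iff.2 hupper, log_iff.2 hlower⟩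
  exact ⟨hH.asympOptimalNull_ST hadm, hH.asympOptimalNull_modST hadm r,
    hH.asympEquiv_ess_one_ST hadm, hH.muchGreater_optEss_one hadm,
    hH.asympLE_ess_one_modST hadm r, hH.asympEquiv_two_div_mul_ess_one_ST hadm⟩

/-- `K α β` is the maximum number of stages, as a function of the error levels. The number `r` is
the least size allowed for the stages of mod-ST after the first (positive or nonnegative
integers). -/
theorem mainTheorem4 {S : Type*} [MeasurableSpace S] (H : SimpleTesting S)
    (hI0 : 0 < H.kl 0 ∧ H.kl 0 < ∞) (hI1 : 0 < H.kl 1 ∧ H.kl 1 < ∞)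
    (r : ℕ) (hr : r = 0 ∨ r = 1)
    (K : ℝ → ℝ → ℕ) (hK : ∀ α ∈ Ioo (0 : ℝ) 1, ∀ β ∈ Ioo (0 : ℝ) 1, 1 ≤ K α β) :
    -- the two forms of the condition on `K` are equivalent
    ((Tendsto (fun p : ℝ × ℝ => p.1 ^ (1 / (K p.1 p.2 : ℝ))) smallErrors (𝓝 0) ∧
        MuchLess smallErrors (fun p => |Real.log (p.1 ^ (1 / (K p.1 p.2 : ℝ)))|)
          (fun p => |Real.log p.2|)) ↔
      (MuchLess smallErrors (fun p => |Real.log p.1| / |Real.log p.2|)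
          (fun p => (K p.1 p.2 : ℝ)) ∧
        MuchLess smallErrors (fun p => (K p.1 p.2 : ℝ)) (fun p => |Real.log p.1|))) ∧
    -- the results under this condition
    (MuchLess smallErrors (fun p => |Real.log p.1| / |Real.log p.2|)
        (fun p => (K p.1 p.2 : ℝ)) →
      MuchLess smallErrors (fun p => (K p.1 p.2 : ℝ)) (fun p => |Real.log p.1|) →
      H.AsympOptimalNull (fun α β => H.ST α β (K α β)) ∧
      H.AsympOptimalNull (fun α β => H.modST r α β (K α β)) ∧
      AsympEquiv smallErrors
        (fun p => H.ess 1 (H.ST p.1 p.2 (K p.1 p.2)).1)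
        (fun p => ENNReal.ofReal
          ((K p.1 p.2 : ℝ) * ((K p.1 p.2 : ℝ) + 1) / 2 * (|Real.log p.2| / H.I 0))) ∧
      MuchGreater smallErrors
        (fun p => ENNReal.ofReal
          ((K p.1 p.2 : ℝ) * ((K p.1 p.2 : ℝ) + 1) / 2 * (|Real.log p.2| / H.I 0)))
        (fun p => ENNReal.ofReal (((K p.1 p.2 : ℝ) + 1) / 2) * H.optEss 1 p.1 p.2) ∧
      AsympLE smallErrors
        (fun p => H.ess 1 (H.modST r p.1 p.2 (K p.1 p.2)).1)
        (fun p => ENNReal.ofReal ((K p.1 p.2 : ℝ) * (|Real.log p.2| / H.I 0))) ∧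
      AsympEquiv smallErrors
        (fun p => ENNReal.ofReal ((K p.1 p.2 : ℝ) * (|Real.log p.2| / H.I 0)))
        (fun p => ENNReal.ofReal (2 / ((K p.1 p.2 : ℝ) + 1)) *
          H.ess 1 (H.ST p.1 p.2 (K p.1 p.2)).1)) :=
  mainTheorem4_general H hI0 (InformationTheory.klDiv_ne_top_iff.1 hI1.2.ne).1 r K hK
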